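/- **Conventions.** Let $(B,g)$ be a (smooth, finite-dimensional) pseudo-Riemannian manifold with Levi-Civita derivative $\nabla$, let $\sigma=\pm1$, and let $\pi:P\to B$ be a principal $S^1$-bundle, where the Lie algebra of $S^1=U(1)$ is $i\mathbb R$. For a connection form $A:TP\to i\mathbb R$ let $v$ be the vertical field on $P$ with $A(v)=i$ (the fundamental field of $i$). For a vector field $X$ on $B$ let $\hat X$ be its horizontal lift ($A(\hat X)=0$, $T\pi(\hat X)=X$). Let $\Omega(X,Y)=-A([\hat X,\hat Y])$ be the curvature form of $A$, an $i\mathbb R$-valued 2-form on $B$; $A$ is flat if its curvature form is zero. Let $\phi$ be the endomorphism field of $TB$ with $g(\phi X,Y)=\sigma\frac i2\Omega(X,Y)$. Let $\tilde g=\pi^*g+\sigma A\otimes A$ be the Kaluza–Klein metric on $P$, with Levi-Civita derivative $D$. A nowhere vanishing vector field $R$ on $P$ is recurrent if $DR=\omega\otimes R$ for some 1-form $\omega$ on $P$. For 1-forms, $d\eta(X,Y)=X(\eta(Y))-Y(\eta(X))-\eta([X,Y])$. **Proposition.** (i) Let $A$ be a connection form on $P$ and $\tilde g=\pi^*g+\sigma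 A\otimes A$. Let $\xi$ be a vector field on $B$ with $g(\xi,\xi)=\sigma$, let $f,h\in C^\infty(P)$, and suppose that $\tilde R=f\hat\xi+hv$ is a light-like recurrent vector field on $(P,\tilde g)$. Then $\varepsilon=\operatorname{sign}(fh)$ takes the values $\pm1$ and is locally constant; it is constant along the fibres, so that it is the pullback of a locally constant function on $B$, also written $\varepsilon$. Moreover $\xi$ is a Killing field of $(B,g)$, and $$D(\hat\xi+\varepsilon v)=0,\qquad \phi\xi=0,\qquad \Omega(\xi,\cdot)=0,\qquad \phi=-\varepsilon\nabla\xi .$$ With the 1-form $\eta=g(\xi,\cdot)$ one has $\Omega=i\sigma\varepsilon\,d\eta$, and $A_0:=A-i\sigma\varepsilon\,\pi^*\eta$ is a flat connection form on $P$. (ii) Conversely, suppose that $\xi$ is a Killing field of $(B,g)$ with $g(\xi,\xi)=\sigma$, that $A_0$ is a flat connection form on $P$, and that $\varepsilon=\pm1$. Put $\eta=g(\xi,\cdot)$. Then $A:=A_0+i\sigma\varepsilon\,\pi^*\eta$ is a connection form on $P$, and for the metric $\tilde g=\pi^*g+\sigma A\otimes A$ (with $\hat\xi$ and $v$ taken with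 respect to $A$) the vector field $\hat\xi+\varepsilon v$ is light-like and parallel, $D(\hat\xi+\varepsilon v)=0$. -/

import Mathlib

set_option linter.unusedSectionVars false
open scoped Manifold ContDiff
open Bundle (TotalSpace Trivialization)
open VectorField (mlieBracket mlieBracket_add_left mlieBracket_add_right mlieBracket_smul_left mlieBracket_smul_right mlieBracket_swap_apply)

section Metric
variable {E : Type*} [NormedAddCommGroup E] [NormedSpace ℝ E]
  {M : Type*} [TopologicalSpace M] [ChartedSpace E M] [IsManifold 𝓘(ℝ, E) ∞ M]

/-- A smooth vector field near `x`: a field of tangent vectors which is smooth at `x`. -/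
def SmoothFieldAt (X : Π x : M, TangentSpace 𝓘(ℝ, E) x) (x : M) : Prop :=
  ContMDiffAt 𝓘(ℝ, E) 𝓘(ℝ, E).tangent ∞ (T% X) x

/-- A smooth vector field on `M`. -/
def IsSmoothField (X : Π x : M, TangentSpace 𝓘(ℝ, E) x) : Prop :=
  ContMDiff 𝓘(ℝ, E) 𝓘(ℝ, E).tangent ∞ (T% X)

/-- A smooth pseudo-Riemannian metric on the manifold `M` modelled on `E`: a smooth field of
nondegenerate symmetric bilinear forms on the tangent spaces. -/
structure PseudoRiemannianMetric (E : Type*) [NormedAddCommGroup E] [NormedSpace ℝ E]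
    (M : Type*) [TopologicalSpace M] [ChartedSpace E M] [IsManifold 𝓘(ℝ, E) ∞ M] where
  inner (x : M) : TangentSpace 𝓘(ℝ, E) x →L[ℝ] TangentSpace 𝓘(ℝ, E) x →L[ℝ] ℝ
  symm (x : M) (u w : TangentSpace 𝓘(ℝ, E) x) : inner x u w = inner x w u
  nondegenerate (x : M) (u : TangentSpace 𝓘(ℝ, E) x) (hu : ∀ w, inner x u w = 0) : u = 0
  contMDiff : ContMDiff 𝓘(ℝ, E) (𝓘(ℝ, E).prod 𝓘(ℝ, E →L[ℝ] E →L[ℝ] ℝ)) ∞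
    (fun x ↦ TotalSpace.mk' (E →L[ℝ] E →L[ℝ] ℝ)
      (E := fun x : M ↦ TangentSpace 𝓘(ℝ, E) x →L[ℝ] TangentSpace 𝓘(ℝ, E) x →L[ℝ] ℝ) x (inner x))

namespace PseudoRiemannianMetric
variable (g : PseudoRiemannianMetric E M)

theorem mdifferentiableAt_inner {X Y : Π x : M, TangentSpace 𝓘(ℝ, E) x} {x : M}
    (hX : MDiffAt (T% X) x) (hY : MDiffAt (T% Y) x) :
    MDiffAt (fun y ↦ g.inner y (X y) (Y y)) x := by
  have h : MDifferentiableAt 𝓘(ℝ, E) (𝓘(ℝ, E).prod 𝓘(ℝ, ℝ))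
      (fun m ↦ TotalSpace.mk' ℝ (E := Bundle.Trivial M ℝ) m (g.inner m (X m) (Y m))) x := by
    apply MDifferentiableAt.clm_bundle_apply₂ (F₁ := E) (F₂ := E)
    · exact g.contMDiff.contMDiffAt.mdifferentiableAt (by simp)
    · exact hX
    · exact hY
  simp only [mdifferentiableAt_totalSpace] at h
  exact h.2

/-- The Koszul expression, which is twice `g(∇_X Y, Z)` for the Levi-Civita derivative `∇`. -/
noncomputable def koszul (X Y Z : Π x : M, TangentSpace 𝓘(ℝ, E) x) (x : M) : ℝ :=
  mvfderiv 𝓘(ℝ, E) (fun y ↦ g.inner y (Y y) (Z y)) x (X x)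
    + mvfderiv 𝓘(ℝ, E) (fun y ↦ g.inner y (X y) (Z y)) x (Y x)
    - mvfderiv 𝓘(ℝ, E) (fun y ↦ g.inner y (X y) (Y y)) x (Z x)
    + g.inner x (mlieBracket 𝓘(ℝ, E) X Y x) (Z x)
    - g.inner x (mlieBracket 𝓘(ℝ, E) X Z x) (Y x)
    - g.inner x (mlieBracket 𝓘(ℝ, E) Y Z x) (X x)

variable [FiniteDimensional ℝ E]
variable {X X' Y Y' Z Z' : Π x : M, TangentSpace 𝓘(ℝ, E) x} {x : M}

theorem koszul_add_left (hX : MDiffAt (T% X) x) (hX' : MDiffAt (T% X') x) (hY : MDiffAt (T% Y) x)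
    (hZ : MDiffAt (T% Z) x) : g.koszul (X + X') Y Z x = g.koszul X Y Z x + g.koszul X' Y Z x := by
  have : IsManifold 𝓘(ℝ, E) 2 M := .of_le (n := ∞) (by norm_cast)
  simp only [koszul, Pi.add_apply, map_add, add_apply,
    mvfderiv_fun_add (g.mdifferentiableAt_inner hX hZ) (g.mdifferentiableAt_inner hX' hZ),
    mvfderiv_fun_add (g.mdifferentiableAt_inner hX hY) (g.mdifferentiableAt_inner hX' hY),
    mlieBracket_add_left hX hX']
  ring

theorem koszul_smul_left {f : M → ℝ} (hf : MDiffAt f x) (hX : MDiffAt (T% X) x)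
    (hY : MDiffAt (T% Y) x) (hZ : MDiffAt (T% Z) x) :
    g.koszul (f • X) Y Z x = f x * g.koszul X Y Z x := by
  have : IsManifold 𝓘(ℝ, E) 2 M := .of_le (n := ∞) (by norm_cast)
  simp only [koszul, Pi.smul_apply', map_smul, map_add, smul_apply, smul_eq_mul,
    mvfderiv_fun_mul hf (g.mdifferentiableAt_inner hX hZ),
    mvfderiv_fun_mul hf (g.mdifferentiableAt_inner hX hY),
    mlieBracket_smul_left hf hX]
  simp [g.symm x (X x)]
  ring


theorem koszul_add_right (hX : MDiffAt (T% X) x) (hY : MDiffAt (T% Y) x) (hZ : MDiffAt (T% Z) x)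
    (hZ' : MDiffAt (T% Z') x) : g.koszul X Y (Z + Z') x = g.koszul X Y Z x + g.koszul X Y Z' x := by
  have : IsManifold 𝓘(ℝ, E) 2 M := .of_le (n := ∞) (by norm_cast)
  simp only [koszul, Pi.add_apply, map_add, add_apply,
    mvfderiv_fun_add (g.mdifferentiableAt_inner hX hZ) (g.mdifferentiableAt_inner hX hZ'),
    mvfderiv_fun_add (g.mdifferentiableAt_inner hY hZ) (g.mdifferentiableAt_inner hY hZ'),
    mlieBracket_add_right hZ hZ']
  ring

theorem koszul_smul_right {f : M → ℝ} (hf : MDiffAt f x) (hX : MDiffAt (T% X) x)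
    (hY : MDiffAt (T% Y) x) (hZ : MDiffAt (T% Z) x) :
    g.koszul X Y (f • Z) x = f x * g.koszul X Y Z x := by
  have : IsManifold 𝓘(ℝ, E) 2 M := .of_le (n := ∞) (by norm_cast)
  simp only [koszul, Pi.smul_apply', map_smul, map_add, smul_eq_mul,
    mvfderiv_fun_mul hf (g.mdifferentiableAt_inner hX hZ),
    mvfderiv_fun_mul hf (g.mdifferentiableAt_inner hY hZ),
    mlieBracket_smul_right hf hZ]
  simp [g.symm x (Z x)]
  ring

theorem koszul_add_mid (hX : MDiffAt (T% X) x) (hY : MDiffAt (T% Y) x) (hY' : MDiffAt (T% Y') x)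
    (hZ : MDiffAt (T% Z) x) : g.koszul X (Y + Y') Z x = g.koszul X Y Z x + g.koszul X Y' Z x := by
  have : IsManifold 𝓘(ℝ, E) 2 M := .of_le (n := ∞) (by norm_cast)
  simp only [koszul, Pi.add_apply, map_add, add_apply,
    mvfderiv_fun_add (g.mdifferentiableAt_inner hX hY) (g.mdifferentiableAt_inner hX hY'),
    mvfderiv_fun_add (g.mdifferentiableAt_inner hY hZ) (g.mdifferentiableAt_inner hY' hZ),
    mlieBracket_add_left hY hY', mlieBracket_add_right hY hY']
  ring

theorem koszul_smul_mid {f : M → ℝ} (hf : MDiffAt f x) (hX : MDiffAt (T% X) x)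
    (hY : MDiffAt (T% Y) x) (hZ : MDiffAt (T% Z) x) :
    g.koszul X (f • Y) Z x =
      f x * g.koszul X Y Z x + 2 * (mvfderiv 𝓘(ℝ, E) f x (X x) * g.inner x (Y x) (Z x)) := by
  have : IsManifold 𝓘(ℝ, E) 2 M := .of_le (n := ∞) (by norm_cast)
  simp only [koszul, Pi.smul_apply', map_smul, map_add, smul_apply, smul_eq_mul,
    mvfderiv_fun_mul hf (g.mdifferentiableAt_inner hX hY),
    mvfderiv_fun_mul hf (g.mdifferentiableAt_inner hY hZ),
    mlieBracket_smul_left hf hY, mlieBracket_smul_right hf hY]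
  simp [g.symm x (Y x)]
  ring

/-- Half of the Koszul expression, as a bilinear form in the first and third field. -/
noncomputable def koszulForm {Y : Π x : M, TangentSpace 𝓘(ℝ, E) x} {x : M}
    (hY : MDiffAt (T% Y) x) :
    TangentSpace 𝓘(ℝ, E) x →L[ℝ] TangentSpace 𝓘(ℝ, E) x →L[ℝ] ℝ :=
  TensorialAt.mkHom₂ (I := 𝓘(ℝ, E)) (F := E) (F' := E) (V := fun x : M ↦ TangentSpace 𝓘(ℝ, E) x)
    (V' := fun x : M ↦ TangentSpace 𝓘(ℝ, E) x)
    (fun X Z ↦ (1 / 2 : ℝ) * g.koszul X Y Z x) x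
    (fun Z hZ ↦ ⟨fun hf hX ↦ by rw [g.koszul_smul_left hf hX hY hZ, smul_eq_mul]; ring,
      fun hX hX' ↦ by rw [g.koszul_add_left hX hX' hY hZ]; ring⟩)
    (fun X hX ↦ ⟨fun hf hZ ↦ by rw [g.koszul_smul_right hf hX hY hZ, smul_eq_mul]; ring,
      fun hZ hZ' ↦ by rw [g.koszul_add_right hX hY hZ hZ']; ring⟩)

theorem koszulForm_apply (hX : MDiffAt (T% X) x) (hY : MDiffAt (T% Y) x) (hZ : MDiffAt (T% Z) x) :
    g.koszulForm hY (X x) (Z x) = (1 / 2 : ℝ) * g.koszul X Y Z x :=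
  TensorialAt.mkHom₂_apply _ _ hX hZ

/-- The isomorphism `u ↦ g(u, ·)` between vectors and covectors. -/
noncomputable def flat (x : M) :
    TangentSpace 𝓘(ℝ, E) x ≃L[ℝ] (TangentSpace 𝓘(ℝ, E) x →L[ℝ] ℝ) :=
  have : FiniteDimensional ℝ (TangentSpace 𝓘(ℝ, E) x) := inferInstanceAs (FiniteDimensional ℝ E)
  have : T2Space (TangentSpace 𝓘(ℝ, E) x) := inferInstanceAs (T2Space E)
  (LinearEquiv.ofInjectiveOfFinrankEq (g.inner x).toLinearMap
    ((injective_iff_map_eq_zero _).2 fun u hu ↦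
      g.nondegenerate x u fun w ↦ by simpa using congrArg (fun L ↦ L w) hu)
    (by
      rw [← Subspace.dual_finrank_eq]
      exact LinearEquiv.finrank_eq LinearMap.toContinuousLinearMap)).toContinuousLinearEquiv

theorem flat_apply (u w : TangentSpace 𝓘(ℝ, E) x) : g.flat x u w = g.inner x u w := rfl

theorem inner_flat_symm (L : TangentSpace 𝓘(ℝ, E) x →L[ℝ] ℝ) (w : TangentSpace 𝓘(ℝ, E) x) :
    g.inner x ((g.flat x).symm L) w = L w := by
  rw [← flat_apply, ContinuousLinearEquiv.apply_symm_apply]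

open scoped Classical in
/-- The vector valued one-form `v ↦ ∇_v Y`, obtained from the Koszul formula where `Y` is
differentiable (and set to zero elsewhere). -/
noncomputable def leviCivitaAux (Y : Π x : M, TangentSpace 𝓘(ℝ, E) x) (x : M) :
    TangentSpace 𝓘(ℝ, E) x →L[ℝ] TangentSpace 𝓘(ℝ, E) x :=
  if hY : MDiffAt (T% Y) x then
    ((g.flat x).symm : (TangentSpace 𝓘(ℝ, E) x →L[ℝ] ℝ) →L[ℝ] TangentSpace 𝓘(ℝ, E) x) ∘L
      g.koszulForm hY
  else 0

theorem two_mul_inner_leviCivitaAux (hX : MDiffAt (T% X) x) (hY : MDiffAt (T% Y) x)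
    (hZ : MDiffAt (T% Z) x) :
    2 * g.inner x (g.leviCivitaAux Y x (X x)) (Z x) = g.koszul X Y Z x := by
  rw [leviCivitaAux, dif_pos hY]
  simp only [ContinuousLinearMap.comp_apply, ContinuousLinearEquiv.coe_coe]
  rw [inner_flat_symm, g.koszulForm_apply hX hY hZ]
  ring

theorem ext_inner {x : M} {L L' : TangentSpace 𝓘(ℝ, E) x →L[ℝ] TangentSpace 𝓘(ℝ, E) x}
    (h : ∀ X Z : Π x : M, TangentSpace 𝓘(ℝ, E) x, MDiffAt (T% X) x → MDiffAt (T% Z) x →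
      g.inner x (L (X x)) (Z x) = g.inner x (L' (X x)) (Z x)) : L = L' := by
  ext u
  rw [← sub_eq_zero]
  refine g.nondegenerate x _ fun w ↦ ?_
  have := h (FiberBundle.extend E u) (FiberBundle.extend E w)
    (FiberBundle.mdifferentiableAt_extend _ _ _) (FiberBundle.mdifferentiableAt_extend _ _ _)
  simpa [sub_eq_zero] using this

/-- The Levi-Civita covariant derivative of `g`: `g.leviCivita Y x v` is `∇_v Y` at `x`. It is
torsion-free (`leviCivita_torsion_free`) and metric (`leviCivita_metric`). -/
noncomputable def leviCivita :
    CovariantDerivative 𝓘(ℝ, E) E (fun x : M ↦ TangentSpace 𝓘(ℝ, E) x) where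
  toFun := g.leviCivitaAux
  isCovariantDerivativeOnUniv :=
    { add := by
        intro Y Y' x hY hY' _
        refine g.ext_inner fun X Z hX hZ ↦ ?_
        have h1 := g.two_mul_inner_leviCivitaAux hX hY hZ
        have h2 := g.two_mul_inner_leviCivitaAux hX hY' hZ
        have h3 := g.two_mul_inner_leviCivitaAux hX (mdifferentiableAt_add_section hY hY') hZ
        have h4 := g.koszul_add_mid hX hY hY' hZ
        simp only [add_apply, map_add]
        linarith
      leibniz := by
        intro Y f x hY hf _
        refine g.ext_inner fun X Z hX hZ ↦ ?_
        have h1 := g.two_mul_inner_leviCivitaAux hX hY hZ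
        have h3 := g.two_mul_inner_leviCivitaAux hX (hf.smul_section hY) hZ
        have h4 := g.koszul_smul_mid hf hX hY hZ
        simp only [add_apply, map_add, smul_apply, map_smul, smul_eq_mul,
          ContinuousLinearMap.smulRight_apply]
        linear_combination (1 / 2) * h3 + (1 / 2) * h4 - (f x / 2) * h1 }

theorem two_mul_inner_leviCivita (hX : MDiffAt (T% X) x) (hY : MDiffAt (T% Y) x)
    (hZ : MDiffAt (T% Z) x) :
    2 * g.inner x (g.leviCivita Y x (X x)) (Z x) = g.koszul X Y Z x :=
  g.two_mul_inner_leviCivitaAux hX hY hZ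

theorem leviCivita_torsion_free (hX : MDiffAt (T% X) x) (hY : MDiffAt (T% Y) x) :
    g.leviCivita Y x (X x) - g.leviCivita X x (Y x) = mlieBracket 𝓘(ℝ, E) X Y x := by
  rw [← sub_eq_zero]
  refine g.nondegenerate x _ fun w ↦ ?_
  have hw : MDiffAt (T% (FiberBundle.extend E w : Π x : M, TangentSpace 𝓘(ℝ, E) x)) x :=
    FiberBundle.mdifferentiableAt_extend _ _ _
  have h1 := g.two_mul_inner_leviCivita hX hY hw
  have h2 := g.two_mul_inner_leviCivita hY hX hw
  simp only [koszul, FiberBundle.extend_apply_self, mlieBracket_swap_apply (V := Y) (W := X),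
    map_neg, neg_apply] at h1 h2
  have h3 : (fun y ↦ g.inner y (Y y) (X y)) = fun y ↦ g.inner y (X y) (Y y) :=
    funext fun y ↦ g.symm ..
  rw [h3] at h2
  simp only [map_sub, sub_apply]
  linarith

theorem leviCivita_metric (hX : MDiffAt (T% X) x) (hY : MDiffAt (T% Y) x)
    (hZ : MDiffAt (T% Z) x) :
    mvfderiv 𝓘(ℝ, E) (fun y ↦ g.inner y (Y y) (Z y)) x (X x) =
      g.inner x (g.leviCivita Y x (X x)) (Z x) + g.inner x (Y x) (g.leviCivita Z x (X x)) := by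
  have h1 := g.two_mul_inner_leviCivita hX hY hZ
  have h2 := g.two_mul_inner_leviCivita hX hZ hY
  have h3 : (fun y ↦ g.inner y (Z y) (Y y)) = fun y ↦ g.inner y (Y y) (Z y) :=
    funext fun y ↦ g.symm ..
  simp only [koszul, mlieBracket_swap_apply (V := Z) (W := Y), map_neg, neg_apply, h3] at h1 h2
  rw [g.symm x (Y x)]
  linarith


/-- A field of bilinear forms is smooth as soon as its value on smooth fields is. -/
theorem contMDiff_bilin_of_fields
    (β : Π x : M, TangentSpace 𝓘(ℝ, E) x →L[ℝ] TangentSpace 𝓘(ℝ, E) x →L[ℝ] ℝ)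
    (h : ∀ (x : M) (X Y : Π x : M, TangentSpace 𝓘(ℝ, E) x),
      ContMDiffAt 𝓘(ℝ, E) 𝓘(ℝ, E).tangent ∞ (T% X) x →
      ContMDiffAt 𝓘(ℝ, E) 𝓘(ℝ, E).tangent ∞ (T% Y) x →
      ContMDiffAt 𝓘(ℝ, E) 𝓘(ℝ, ℝ) ∞ (fun y ↦ β y (X y) (Y y)) x) :
    ContMDiff 𝓘(ℝ, E) (𝓘(ℝ, E).prod 𝓘(ℝ, E →L[ℝ] E →L[ℝ] ℝ)) ∞
      (fun x ↦ TotalSpace.mk' (E →L[ℝ] E →L[ℝ] ℝ)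
        (E := fun x : M ↦ TangentSpace 𝓘(ℝ, E) x →L[ℝ] TangentSpace 𝓘(ℝ, E) x →L[ℝ] ℝ) x (β x)) := by
  intro x₀
  rw [contMDiffAt_hom_bundle]
  refine ⟨contMDiffAt_id, ?_⟩
  let b := Module.finBasis ℝ E
  let t := trivializationAt E (fun x : M ↦ TangentSpace 𝓘(ℝ, E) x) x₀
  have hx₀ : x₀ ∈ t.baseSet := mem_baseSet_trivializationAt ..
  let c (i) : E →L[ℝ] ℝ := LinearMap.toContinuousLinearMap (b.coord i)
  let T (i j) : E →L[ℝ] E →L[ℝ] ℝ := (c i).smulRight (c j)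
  have key : ∀ L : E →L[ℝ] E →L[ℝ] ℝ, L = ∑ i, ∑ j, L (b i) (b j) • T i j := by
    intro L
    refine ContinuousLinearMap.coe_injective (b.ext fun i ↦ ?_)
    refine ContinuousLinearMap.coe_injective (b.ext fun j ↦ ?_)
    simp [T, c, Finsupp.single_apply, Finset.sum_ite_eq]
  have hs : ∀ i, ContMDiffAt 𝓘(ℝ, E) 𝓘(ℝ, E).tangent ∞ (T% (t.localFrame b i)) x₀ := fun i ↦
    contMDiffAt_localFrame_of_mem ∞ t b i hx₀
  have hsm : ContMDiffAt 𝓘(ℝ, E) 𝓘(ℝ, E →L[ℝ] E →L[ℝ] ℝ) ∞ (fun x : M ↦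
      ∑ i, ∑ j, (β x (t.localFrame b i x) (t.localFrame b j x)) • T i j) x₀ := by
    refine ContMDiffAt.sum fun i _ ↦ ContMDiffAt.sum fun j _ ↦ ?_
    exact (h x₀ _ _ (hs i) (hs j)).smul contMDiffAt_const
  refine hsm.congr_of_eventuallyEq ?_
  filter_upwards [t.open_baseSet.mem_nhds hx₀] with x hx
  conv_lhs => rw [key (ContinuousLinearMap.inCoordinates _ _ _ _ _ _ _ _ _)]
  refine Finset.sum_congr rfl fun i _ ↦ Finset.sum_congr rfl fun j _ ↦ ?_
  congr 1
  rw [inCoordinates_apply_eq₂ hx hx (by simp)]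
  simp [t, t.localFrame_apply_of_mem_baseSet b hx, Trivialization.basisAt]

/-- `R` is light-like: nowhere zero and of zero length. -/
def IsLightLike (R : Π x : M, TangentSpace 𝓘(ℝ, E) x) : Prop :=
  ∀ x, R x ≠ 0 ∧ g.inner x (R x) (R x) = 0

/-- `R` is a recurrent vector field: it is nowhere zero and `∇R = θ ⊗ R` for a one-form `θ`. -/
def IsRecurrent (R : Π x : M, TangentSpace 𝓘(ℝ, E) x) : Prop :=
  IsSmoothField R ∧ (∀ x, R x ≠ 0) ∧
    ∃ θ : Π x : M, TangentSpace 𝓘(ℝ, E) x →L[ℝ] ℝ,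
      ContMDiff 𝓘(ℝ, E) (𝓘(ℝ, E).prod 𝓘(ℝ, E →L[ℝ] ℝ)) ∞
        (fun x ↦ TotalSpace.mk' (E →L[ℝ] ℝ) (E := fun x : M ↦ TangentSpace 𝓘(ℝ, E) x →L[ℝ] ℝ)
          x (θ x)) ∧
      ∀ (x : M) (u : TangentSpace 𝓘(ℝ, E) x), g.leviCivita R x u = θ x u • R x

/-- `R` is a parallel vector field: it is smooth and `∇R = 0`. -/
def IsParallel (R : Π x : M, TangentSpace 𝓘(ℝ, E) x) : Prop :=
  IsSmoothField R ∧ ∀ (x : M) (u : TangentSpace 𝓘(ℝ, E) x), g.leviCivita R x u = 0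

/-- `X` is a Killing vector field: it is smooth and the Lie derivative of `g` along `X` vanishes,
that is, `X(g(Y, Z)) = g([X, Y], Z) + g(Y, [X, Z])`. -/
def IsKilling (X : Π x : M, TangentSpace 𝓘(ℝ, E) x) : Prop :=
  IsSmoothField X ∧ ∀ (x : M) (Y Z : Π x : M, TangentSpace 𝓘(ℝ, E) x),
    SmoothFieldAt Y x → SmoothFieldAt Z x →
      mvfderiv 𝓘(ℝ, E) (fun y ↦ g.inner y (Y y) (Z y)) x (X x) =
        g.inner x (mlieBracket 𝓘(ℝ, E) X Y x) (Z x) + g.inner x (Y x) (mlieBracket 𝓘(ℝ, E) X Z x)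

end PseudoRiemannianMetric

/-- The exterior derivative of a one-form,
`dη(X, Y) = X(η(Y)) - Y(η(X)) - η([X, Y])`. -/
noncomputable def exteriorDerivative (η : Π x : M, TangentSpace 𝓘(ℝ, E) x →L[ℝ] ℝ)
    (X Y : Π x : M, TangentSpace 𝓘(ℝ, E) x) (x : M) : ℝ :=
  mvfderiv 𝓘(ℝ, E) (fun y ↦ η y (Y y)) x (X x) - mvfderiv 𝓘(ℝ, E) (fun y ↦ η y (X y)) x (Y x)
    - η x (mlieBracket 𝓘(ℝ, E) X Y x)

end Metric

section Bundle
variable {E : Type*} [NormedAddCommGroup E] [NormedSpace ℝ E]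
  {B : Type*} [TopologicalSpace B] [ChartedSpace E B]
  {F : Type*} [NormedAddCommGroup F] [NormedSpace ℝ F]
  {P : Type*} [TopologicalSpace P] [ChartedSpace F P] [MulAction Circle P]

/-- `π : P → B` is a smooth principal `S¹`-bundle: `Circle` acts smoothly on `P`, and `π` is locally
isomorphic, by equivariant diffeomorphisms over the base, to `U × S¹ → U`. As the group is abelian,
left and right actions are the same thing. -/
structure IsPrincipalCircleBundle (E F : Type*) [NormedAddCommGroup E] [NormedSpace ℝ E]
    [NormedAddCommGroup F] [NormedSpace ℝ F] {B P : Type*} [TopologicalSpace B] [ChartedSpace E B]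
    [TopologicalSpace P] [ChartedSpace F P] [MulAction Circle P] (π : P → B) : Prop where
  contMDiff_smul : ContMDiff ((𝓡 1).prod 𝓘(ℝ, F)) 𝓘(ℝ, F) ∞ (fun q : Circle × P ↦ q.1 • q.2)
  contMDiff_proj : ContMDiff 𝓘(ℝ, F) 𝓘(ℝ, E) ∞ π
  proj_smul (z : Circle) (p : P) : π (z • p) = π p
  exists_trivialization (b : B) : ∃ e : Trivialization Circle π, b ∈ e.baseSet ∧
    ContMDiffOn 𝓘(ℝ, F) (𝓘(ℝ, E).prod (𝓡 1)) ∞ e e.source ∧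
    ContMDiffOn (𝓘(ℝ, E).prod (𝓡 1)) 𝓘(ℝ, F) ∞ e.toOpenPartialHomeomorph.symm e.target ∧
    ∀ p ∈ e.source, ∀ z : Circle, (e (z • p)).2 = z * (e p).2

/-- The fundamental vector field of `a * i` in the Lie algebra `iℝ` of `S¹`: at `p` it is
`d/dt (p · exp(t a i))` at `t = 0`. For every connection form `A`, the field `v` with `Tπ(v) = 0`
and `A(v) = i` is `fundamentalField F 1`. -/
noncomputable def fundamentalField (F : Type*) [NormedAddCommGroup F] [NormedSpace ℝ F]
    {P : Type*} [TopologicalSpace P] [ChartedSpace F P] [MulAction Circle P] (a : ℝ) (p : P) :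
    TangentSpace 𝓘(ℝ, F) p :=
  (mfderiv 𝓘(ℝ, ℝ) 𝓘(ℝ, F) (fun t : ℝ ↦ Circle.exp (t * a) • p) 0 : ℝ →L[ℝ] F) 1

/-- A connection form on a principal `S¹`-bundle `P`: a smooth one-form with values in `iℝ`, invariant
under the action, which maps the fundamental vector field of each element of `iℝ` to this element.
The Lie algebra `iℝ` is realised as the set of imaginary complex numbers. -/
structure ConnectionForm (F : Type*) [NormedAddCommGroup F] [NormedSpace ℝ F]
    (P : Type*) [TopologicalSpace P] [ChartedSpace F P] [IsManifold 𝓘(ℝ, F) ∞ P]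
    [MulAction Circle P] where
  form (p : P) : TangentSpace 𝓘(ℝ, F) p →L[ℝ] ℂ
  contMDiff : ContMDiff 𝓘(ℝ, F) (𝓘(ℝ, F).prod 𝓘(ℝ, F →L[ℝ] ℂ)) ∞
    (fun p ↦ TotalSpace.mk' (F →L[ℝ] ℂ) (E := fun p : P ↦ TangentSpace 𝓘(ℝ, F) p →L[ℝ] ℂ)
      p (form p))
  re_eq_zero (p : P) (u : TangentSpace 𝓘(ℝ, F) p) : (form p u).re = 0
  invariant (z : Circle) (p : P) (u : TangentSpace 𝓘(ℝ, F) p) :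
    form (z • p) (mfderiv 𝓘(ℝ, F) 𝓘(ℝ, F) (fun q : P ↦ z • q) p u) = form p u
  fundamental (a : ℝ) (p : P) : form p (fundamentalField F a p) = a * Complex.I

namespace IsPrincipalCircleBundle
variable {π : P → B}

theorem mdifferentiableAt_proj (hπ : IsPrincipalCircleBundle E F π) (p : P) :
    MDifferentiableAt 𝓘(ℝ, F) 𝓘(ℝ, E) π p :=
  hπ.contMDiff_proj.contMDiffAt.mdifferentiableAt (by simp)

/-- Chain rule along an orbit. -/
theorem mdifferentiableAt_comp_orbit (hπ : IsPrincipalCircleBundle E F π) (a : ℝ) (p : P)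
    {G : Type*} [NormedAddCommGroup G] [NormedSpace ℝ G] {H : Type*} [TopologicalSpace H]
    {J : ModelWithCorners ℝ G H} {N : Type*} [TopologicalSpace N] [ChartedSpace H N]
    {k : P → N} (hk : MDifferentiableAt 𝓘(ℝ, F) J k p) :
    MDifferentiableAt 𝓘(ℝ, ℝ) J (fun t : ℝ ↦ k (Circle.exp (t * a) • p)) 0 ∧
    (mfderiv 𝓘(ℝ, ℝ) J (fun t : ℝ ↦ k (Circle.exp (t * a) • p)) 0 : ℝ →L[ℝ] G) 1 =
      (mfderiv 𝓘(ℝ, F) J k p : F →L[ℝ] G) (fundamentalField F a p) := by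
  have h1 : ContMDiff 𝓘(ℝ, ℝ) (𝓡 1) ∞ (fun t : ℝ ↦ Circle.exp (t * a)) :=
    contMDiff_circleExp.comp (contDiff_id.mul contDiff_const).contMDiff
  have h2 : ContMDiff 𝓘(ℝ, ℝ) 𝓘(ℝ, F) ∞ (fun t : ℝ ↦ Circle.exp (t * a) • p) :=
    hπ.contMDiff_smul.comp (h1.prodMk contMDiff_const)
  have h3 := (h2.contMDiffAt (x := 0)).mdifferentiableAt (by simp) |>.hasMFDerivAt
  have h0 : Circle.exp (0 * a) • p = p := by simp
  have h4 : ∀ q, q = p → HasMFDerivAt 𝓘(ℝ, F) J k q (mfderiv 𝓘(ℝ, F) J k p : F →L[ℝ] G) := by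
    rintro _ rfl
    exact hk.hasMFDerivAt
  have h5 := HasMFDerivAt.comp (0 : ℝ) (h4 _ h0) h3
  exact ⟨h5.mdifferentiableAt, congrArg (fun L : ℝ →L[ℝ] G ↦ L 1) h5.mfderiv⟩

theorem mfderiv_proj_fundamentalField (hπ : IsPrincipalCircleBundle E F π) (a : ℝ) (p : P) :
    mfderiv 𝓘(ℝ, F) 𝓘(ℝ, E) π p (fundamentalField F a p) = 0 := by
  have h := (hπ.mdifferentiableAt_comp_orbit a p (hπ.mdifferentiableAt_proj p)).2
  have h1 : HasMFDerivAt 𝓘(ℝ, ℝ) 𝓘(ℝ, E) (fun t : ℝ ↦ π (Circle.exp (t * a) • p)) 0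
      (0 : ℝ →L[ℝ] E) :=
    (hasMFDerivAt_const (π p) (0 : ℝ)).congr_of_eventuallyEq
      (Filter.Eventually.of_forall fun t ↦ hπ.proj_smul _ _)
  exact h.symm.trans (congrArg (fun L : ℝ →L[ℝ] E ↦ L 1) h1.mfderiv)

theorem exists_mfderiv_proj_eq (hπ : IsPrincipalCircleBundle E F π) (p : P)
    (x : TangentSpace 𝓘(ℝ, E) (π p)) :
    ∃ u : TangentSpace 𝓘(ℝ, F) p, mfderiv 𝓘(ℝ, F) 𝓘(ℝ, E) π p u = x := by
  obtain ⟨e, hb, he, hes, -⟩ := hπ.exists_trivialization (π p)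
  have hp : p ∈ e.source := by rw [e.source_eq]; exact hb
  let s : B → P := fun b ↦ e.toOpenPartialHomeomorph.symm (b, (e p).2)
  have hsp : s (π p) = p := by
    have : (π p, (e p).2) = e p := Prod.ext (e.proj_toFun p hp).symm rfl
    simp only [s, this]
    exact e.toOpenPartialHomeomorph.left_inv hp
  have hmem : ∀ b ∈ e.baseSet, (b, (e p).2) ∈ e.target := fun b hb ↦ by
    rw [e.target_eq]; exact ⟨hb, trivial⟩
  have hs : MDifferentiableAt 𝓘(ℝ, E) 𝓘(ℝ, F) s (π p) := by
    have h1 := (hes.contMDiffAt (e.open_target.mem_nhds (hmem _ hb))).mdifferentiableAt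
      (by simp)
    exact h1.comp (π p) (mdifferentiableAt_id.prodMk mdifferentiableAt_const)
  have hid : (fun b ↦ π (s b)) =ᶠ[nhds (π p)] id := by
    filter_upwards [e.open_baseSet.mem_nhds hb] with b hb
    have h1 := e.toOpenPartialHomeomorph.map_target (hmem b hb)
    have h2 := e.proj_toFun _ h1
    have h3 := e.toOpenPartialHomeomorph.right_inv (hmem b hb)
    rw [h3] at h2
    exact h2.symm
  have h1 : ∀ q, q = p →
      HasMFDerivAt 𝓘(ℝ, F) 𝓘(ℝ, E) π q (mfderiv 𝓘(ℝ, F) 𝓘(ℝ, E) π p : F →L[ℝ] E) := by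
    rintro _ rfl
    exact (hπ.mdifferentiableAt_proj _).hasMFDerivAt
  have h2 := ((h1 _ hsp).comp (π p) hs.hasMFDerivAt).congr_of_eventuallyEq hid.symm
  have h3 := hasMFDerivAt_unique h2 (hasMFDerivAt_id (π p))
  refine ⟨(mfderiv 𝓘(ℝ, E) 𝓘(ℝ, F) s (π p) : E →L[ℝ] F) x, ?_⟩
  exact congrArg (fun L : E →L[ℝ] E ↦ L x) h3

theorem exists_eq_smul_fundamentalField (hπ : IsPrincipalCircleBundle E F π) (p : P)
    (u : TangentSpace 𝓘(ℝ, F) p) (hu : mfderiv 𝓘(ℝ, F) 𝓘(ℝ, E) π p u = 0) :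
    ∃ c : ℝ, u = c • fundamentalField F 1 p := by
  obtain ⟨e, hb, he, hes, hequiv⟩ := hπ.exists_trivialization (π p)
  have hp : p ∈ e.source := by rw [e.source_eq]; exact hb
  have hed := (he.contMDiffAt (e.open_source.mem_nhds hp)).mdifferentiableAt (by simp)
  have hesd := (hes.contMDiffAt (e.open_target.mem_nhds
    (e.toOpenPartialHomeomorph.map_source hp))).mdifferentiableAt (by simp)
  have hζ : MDifferentiableAt 𝓘(ℝ, F) (𝓡 1) (fun q ↦ (e q).2) p := hed.snd
  -- the two components of the differential of the trivialization are jointly injective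
  have hinj : ∀ w : TangentSpace 𝓘(ℝ, F) p, mfderiv 𝓘(ℝ, F) 𝓘(ℝ, E) π p w = 0 →
      mfderiv 𝓘(ℝ, F) (𝓡 1) (fun q ↦ (e q).2) p w = 0 → w = 0 := by
    intro w hw1 hw2
    have h1 : (fun q ↦ (π q, (e q).2)) =ᶠ[nhds p] e := by
      filter_upwards [e.open_source.mem_nhds hp] with q hq
      exact Prod.ext (e.proj_toFun q hq).symm rfl
    have h2 := ((hπ.mdifferentiableAt_proj p).hasMFDerivAt.prodMk hζ.hasMFDerivAt)
      |>.congr_of_eventuallyEq h1.symm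
    have h3 : (fun q ↦ e.toOpenPartialHomeomorph.symm (e q)) =ᶠ[nhds p] id := by
      filter_upwards [e.open_source.mem_nhds hp] with q hq
      exact e.toOpenPartialHomeomorph.left_inv hq
    have h4 := (hesd.hasMFDerivAt.comp p h2).congr_of_eventuallyEq h3.symm
    have h5 := hasMFDerivAt_unique h4 (hasMFDerivAt_id p)
    have h6 := congrArg (fun L : F →L[ℝ] F ↦ L w) h5
    refine h6.symm.trans ?_
    have h7 : (((mfderiv 𝓘(ℝ, F) 𝓘(ℝ, E) π p : F →L[ℝ] E).prod
        (mfderiv 𝓘(ℝ, F) (𝓡 1) (fun q ↦ (e q).2) p : F →L[ℝ] EuclideanSpace ℝ (Fin 1))) w) = 0 :=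
      Prod.ext hw1 hw2
    exact (congrArg (mfderiv (𝓘(ℝ, E).prod (𝓡 1)) 𝓘(ℝ, F) e.toOpenPartialHomeomorph.symm (e p) :
      E × EuclideanSpace ℝ (Fin 1) →L[ℝ] F) h7).trans (map_zero _)
  have hv : mfderiv 𝓘(ℝ, F) (𝓡 1) (fun q ↦ (e q).2) p (fundamentalField F 1 p) ≠ 0 := by
    intro h0
    let co : Circle → ℂ := fun z ↦ (z : ℂ)
    have hco : ContMDiff (𝓡 1) 𝓘(ℝ, ℂ) ∞ co :=
      have : Fact (Module.finrank ℝ ℂ = 1 + 1) := Complex.finrank_real_complex_fact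
      contMDiff_coe_sphere
    have h3 : MDifferentiableAt (𝓡 1) 𝓘(ℝ, ℂ) co (e p).2 :=
      hco.contMDiffAt.mdifferentiableAt (by simp)
    have h4 := (hπ.mdifferentiableAt_comp_orbit 1 p (h3.comp p hζ)).2
    have h5 : HasFDerivAt (fun t : ℝ ↦ Complex.exp (t * Complex.I) * ((e p).2 : ℂ))
        (ContinuousLinearMap.toSpanSingleton ℝ (Complex.I * ((e p).2 : ℂ))) 0 := by
      have := ((Complex.ofRealCLM.hasDerivAt (x := 0)).mul_const Complex.I).cexp.mul_const
        ((e p).2 : ℂ)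
      simpa using this.hasFDerivAt
    have h6 : HasMFDerivAt 𝓘(ℝ, ℝ) 𝓘(ℝ, ℂ)
        (fun t : ℝ ↦ (co ∘ fun q ↦ (e q).2) (Circle.exp (t * 1) • p)) 0
        (ContinuousLinearMap.toSpanSingleton ℝ (Complex.I * ((e p).2 : ℂ))) :=
      h5.hasMFDerivAt.congr_of_eventuallyEq
        (Filter.Eventually.of_forall fun t ↦ by simp [co, hequiv p hp])
    have h7 := congrArg (fun L : ℝ →L[ℝ] ℂ ↦ L 1) h6.mfderiv
    have h8 : (mfderiv 𝓘(ℝ, F) 𝓘(ℝ, ℂ) (co ∘ fun q ↦ (e q).2) p : F →L[ℝ] ℂ)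
        (fundamentalField F 1 p) = 0 := by
      have h9 := congrArg (fun L : F →L[ℝ] ℂ ↦ L (fundamentalField F 1 p))
        (mfderiv_comp p h3 hζ)
      refine h9.trans ?_
      exact (congrArg (mfderiv (𝓡 1) 𝓘(ℝ, ℂ) co (e p).2 : EuclideanSpace ℝ (Fin 1) →L[ℝ] ℂ)
        h0).trans (map_zero _)
    have h10 : (Complex.I * ((e p).2 : ℂ)) = 0 :=
      (one_smul ℝ _).symm.trans (h7.symm.trans (h4.trans h8))
    simp at h10
  obtain ⟨c, hc⟩ := exists_smul_eq_of_finrank_eq_one 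
    (K := ℝ) (V := TangentSpace (𝓡 1) (e p).2) (finrank_euclideanSpace_fin (n := 1)) hv (mfderiv 𝓘(ℝ, F) (𝓡 1) (fun q ↦ (e q).2) p u)
  refine ⟨c, sub_eq_zero.1 (hinj _ ?_ ?_)⟩
  · rw [map_sub, map_smul, hu, hπ.mfderiv_proj_fundamentalField, smul_zero, sub_zero]
  · rw [map_sub, map_smul, sub_eq_zero]; exact hc.symm

variable [IsManifold 𝓘(ℝ, E) ∞ B] [IsManifold 𝓘(ℝ, F) ∞ P]

theorem eq_zero_of_vertical_of_form_eq_zero (hπ : IsPrincipalCircleBundle E F π)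
    (A : ConnectionForm F P) {p : P} {u : TangentSpace 𝓘(ℝ, F) p}
    (hu : mfderiv 𝓘(ℝ, F) 𝓘(ℝ, E) π p u = 0) (hA : A.form p u = 0) : u = 0 := by
  obtain ⟨c, rfl⟩ := hπ.exists_eq_smul_fundamentalField p u hu
  rw [map_smul, A.fundamental] at hA
  have hc : c = 0 := by simpa using hA
  rw [hc, zero_smul]

theorem exists_horizontal (hπ : IsPrincipalCircleBundle E F π) (A : ConnectionForm F P) (p : P)
    (x : TangentSpace 𝓘(ℝ, E) (π p)) : ∃ u : TangentSpace 𝓘(ℝ, F) p,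
      A.form p u = 0 ∧ mfderiv 𝓘(ℝ, F) 𝓘(ℝ, E) π p u = x := by
  obtain ⟨u, hu⟩ := hπ.exists_mfderiv_proj_eq p x
  refine ⟨u - (A.form p u).im • fundamentalField F 1 p, ?_, ?_⟩
  · rw [map_sub, map_smul, A.fundamental]
    apply Complex.ext <;> simp [A.re_eq_zero]
  · rw [map_sub, map_smul, hπ.mfderiv_proj_fundamentalField, smul_zero, sub_zero, hu]

/-- The horizontal lift of `X`: the vector field on `P` annihilated by `A` which projects to `X`. -/
noncomputable def horizontalLift (hπ : IsPrincipalCircleBundle E F π) (A : ConnectionForm F P)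
    (X : Π b : B, TangentSpace 𝓘(ℝ, E) b) (p : P) : TangentSpace 𝓘(ℝ, F) p :=
  (hπ.exists_horizontal A p (X (π p))).choose

theorem form_horizontalLift (hπ : IsPrincipalCircleBundle E F π) (A : ConnectionForm F P)
    (X : Π b : B, TangentSpace 𝓘(ℝ, E) b) (p : P) : A.form p (hπ.horizontalLift A X p) = 0 :=
  (hπ.exists_horizontal A p (X (π p))).choose_spec.1

theorem mfderiv_horizontalLift (hπ : IsPrincipalCircleBundle E F π) (A : ConnectionForm F P)
    (X : Π b : B, TangentSpace 𝓘(ℝ, E) b) (p : P) :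
    mfderiv 𝓘(ℝ, F) 𝓘(ℝ, E) π p (hπ.horizontalLift A X p) = X (π p) :=
  (hπ.exists_horizontal A p (X (π p))).choose_spec.2

theorem contMDiffAt_mfderiv_proj (hπ : IsPrincipalCircleBundle E F π)
    {X : Π p : P, TangentSpace 𝓘(ℝ, F) p} {p : P}
    (hX : ContMDiffAt 𝓘(ℝ, F) 𝓘(ℝ, F).tangent ∞ (T% X) p) :
    ContMDiffAt 𝓘(ℝ, F) 𝓘(ℝ, E).tangent ∞ (fun q ↦ TotalSpace.mk' E
      (E := fun b : B ↦ TangentSpace 𝓘(ℝ, E) b) (π q) (mfderiv 𝓘(ℝ, F) 𝓘(ℝ, E) π q (X q))) p :=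
  (hπ.contMDiff_proj.contMDiff_tangentMap (m := ∞) (by simp)).contMDiffAt.comp p hX

theorem contMDiffAt_form (A : ConnectionForm F P) {X : Π p : P, TangentSpace 𝓘(ℝ, F) p} {p : P}
    (hX : ContMDiffAt 𝓘(ℝ, F) 𝓘(ℝ, F).tangent ∞ (T% X) p) :
    ContMDiffAt 𝓘(ℝ, F) 𝓘(ℝ, ℂ) ∞ (fun q ↦ A.form q (X q)) p := by
  have h : ContMDiffAt 𝓘(ℝ, F) (𝓘(ℝ, F).prod 𝓘(ℝ, ℂ)) ∞ (fun q ↦ TotalSpace.mk' ℂ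
      (E := Bundle.Trivial P ℂ) q (A.form q (X q))) p := by
    apply ContMDiffAt.clm_bundle_apply (F₁ := F) (F₂ := ℂ)
    · exact A.contMDiff.contMDiffAt
    · exact hX
  simp only [Bundle.contMDiffAt_totalSpace] at h
  exact h.2

/-- The field of bilinear forms `π^*g + σ A ⊗ A`. The product of two imaginary numbers is real. -/
noncomputable def kaluzaKleinForm (π : P → B) (g : PseudoRiemannianMetric E B)
    (A : ConnectionForm F P) (σ : ℝ) [FiniteDimensional ℝ F] (p : P) :
    TangentSpace 𝓘(ℝ, F) p →L[ℝ] TangentSpace 𝓘(ℝ, F) p →L[ℝ] ℝ :=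
  have : FiniteDimensional ℝ (TangentSpace 𝓘(ℝ, F) p) := inferInstanceAs (FiniteDimensional ℝ F)
  have : T2Space (TangentSpace 𝓘(ℝ, F) p) := inferInstanceAs (T2Space F)
  (LinearMap.mk₂ ℝ (fun u w : TangentSpace 𝓘(ℝ, F) p ↦
    g.inner (π p) (mfderiv 𝓘(ℝ, F) 𝓘(ℝ, E) π p u) (mfderiv 𝓘(ℝ, F) 𝓘(ℝ, E) π p w)
      + σ * (A.form p u * A.form p w).re)
    (fun u u' w ↦ by simp only [map_add, add_apply, add_mul, Complex.add_re]; ring)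
    (fun c u w ↦ by
      simp only [map_smul, smul_apply, Complex.real_smul, Complex.mul_re, Complex.mul_im,
        Complex.ofReal_re, Complex.ofReal_im, smul_eq_mul]
      ring)
    (fun u w w' ↦ by simp only [map_add, mul_add, Complex.add_re]; ring)
    (fun c u w ↦ by
      simp only [map_smul, Complex.real_smul, Complex.mul_re, Complex.mul_im,
        Complex.ofReal_re, Complex.ofReal_im, smul_eq_mul]
      ring)).toContinuousBilinearMap

theorem kaluzaKleinForm_apply (g : PseudoRiemannianMetric E B) (A : ConnectionForm F P) (σ : ℝ)
    [FiniteDimensional ℝ F] (p : P) (u w : TangentSpace 𝓘(ℝ, F) p) :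
    kaluzaKleinForm π g A σ p u w =
      g.inner (π p) (mfderiv 𝓘(ℝ, F) 𝓘(ℝ, E) π p u) (mfderiv 𝓘(ℝ, F) 𝓘(ℝ, E) π p w)
        + σ * (A.form p u * A.form p w).re := rfl

/-- The Kaluza-Klein metric `π^*g + σ A ⊗ A` on `P`. -/
noncomputable def kaluzaKlein (hπ : IsPrincipalCircleBundle E F π)
    (g : PseudoRiemannianMetric E B) (A : ConnectionForm F P) (σ : ℝ) (hσ : σ = 1 ∨ σ = -1)
    [FiniteDimensional ℝ F] : PseudoRiemannianMetric F P where
  inner := kaluzaKleinForm π g A σ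
  symm p u w := by
    rw [kaluzaKleinForm_apply, kaluzaKleinForm_apply, g.symm, mul_comm (A.form p u)]
  nondegenerate p u hu := by
    have hA : A.form p u = 0 := by
      have h := hu (fundamentalField F 1 p)
      rw [kaluzaKleinForm_apply, hπ.mfderiv_proj_fundamentalField, map_zero, A.fundamental] at h
      apply Complex.ext
      · simp [A.re_eq_zero]
      · rcases hσ with rfl | rfl <;> simpa using h
    refine hπ.eq_zero_of_vertical_of_form_eq_zero A (g.nondegenerate _ _ fun x ↦ ?_) hA
    obtain ⟨w, rfl⟩ := hπ.exists_mfderiv_proj_eq p x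
    have h := hu w
    rw [kaluzaKleinForm_apply, hA] at h
    simpa using h
  contMDiff := by
    refine PseudoRiemannianMetric.contMDiff_bilin_of_fields _ fun p X Y hX hY ↦ ?_
    have h1 : ContMDiffAt 𝓘(ℝ, F) (𝓘(ℝ, E).prod 𝓘(ℝ, ℝ)) ∞ (fun q ↦ TotalSpace.mk' ℝ
        (E := Bundle.Trivial B ℝ) (π q) (g.inner (π q) (mfderiv 𝓘(ℝ, F) 𝓘(ℝ, E) π q (X q))
          (mfderiv 𝓘(ℝ, F) 𝓘(ℝ, E) π q (Y q)))) p := by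
      apply ContMDiffAt.clm_bundle_apply₂ (F₁ := E) (F₂ := E)
      · exact g.contMDiff.contMDiffAt.comp p hπ.contMDiff_proj.contMDiffAt
      · exact hπ.contMDiffAt_mfderiv_proj hX
      · exact hπ.contMDiffAt_mfderiv_proj hY
    simp only [Bundle.contMDiffAt_totalSpace] at h1
    have h2 : ContMDiffAt 𝓘(ℝ, F) 𝓘(ℝ, ℂ) ∞ (fun q ↦ A.form q (X q) * A.form q (Y q)) p :=
      (contDiff_mul (𝕜 := ℝ) (𝔸 := ℂ)).contMDiff.contMDiffAt.comp p
        ((contMDiffAt_form A hX).prodMk_space (contMDiffAt_form A hY))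
    have h3 : ContMDiffAt 𝓘(ℝ, F) 𝓘(ℝ, ℝ) ∞ (fun q ↦ (A.form q (X q) * A.form q (Y q)).re) p :=
      Complex.reCLM.contMDiff.contMDiffAt.comp p h2
    exact h1.2.add (contMDiffAt_const.mul h3)

/-- `Ω` is the curvature form on `B` of the connection form `A`: `Ω(X, Y) = -A([X̂, Ŷ])`, where `X̂`
and `Ŷ` are the horizontal lifts of the vector fields `X` and `Y`. This determines `Ω`. -/
def IsCurvatureForm (hπ : IsPrincipalCircleBundle E F π) (A : ConnectionForm F P)
    (Ω : Π b : B, TangentSpace 𝓘(ℝ, E) b →L[ℝ] TangentSpace 𝓘(ℝ, E) b →L[ℝ] ℂ) : Prop :=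
  ∀ (p : P) (X Y : Π b : B, TangentSpace 𝓘(ℝ, E) b),
    SmoothFieldAt X (π p) → SmoothFieldAt Y (π p) →
      Ω (π p) (X (π p)) (Y (π p)) =
        -A.form p (mlieBracket 𝓘(ℝ, F) (hπ.horizontalLift A X) (hπ.horizontalLift A Y) p)

/-- The connection form `A` is flat: its curvature form is zero. -/
def IsFlat (hπ : IsPrincipalCircleBundle E F π) (A : ConnectionForm F P) : Prop :=
  hπ.IsCurvatureForm A (fun _ ↦ 0)

end IsPrincipalCircleBundle
end Bundle

/-!
The Koszul formula reduces the Levi-Civita derivative `D` of the Kaluza-Klein metric to brackets of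
the vertical field `v` and of horizontal lifts `X̂`. Two facts about brackets are needed: `[X̂, Ŷ]`
projects to `[X, Y]` (`mfderiv_mlieBracket_horizontalLift`), so that only its vertical part
`A([X̂, Ŷ])`, the negative of the curvature, is new; and `[v, X̂] = 0`
(`mlieBracket_fundamentalField_horizontalLift`), because horizontal lifts are invariant. Both are
tested on functions, through `[X, Y] k = X (Y k) - Y (X k)` (`mvfderiv_mlieBracket`).

For `Z = ξ̂ + ε v` with `ε` locally constant the formula then reads

* `g̃(D_v Z, v) = 0`,
* `2 g̃(D_v Z, Ŷ) = -i σ A([ξ̂, Ŷ])` and `2 g̃(D_X̂ Z, v) = i σ A([X̂, ξ̂])`,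
* `2 g̃(D_X̂ Z, Ŷ) = 2 g(∇_X ξ, Y) - i ε σ A([X̂, Ŷ])`.

Suppose that `f ξ̂ + h v` is light-like and recurrent. Then `f ^ 2 = h ^ 2` has no zeros, so the
field is `f Z` with `ε = sign (f h)`, and `D_u Z` is a multiple of `Z` for every `u`. As `Z` is not
orthogonal to `v`, this multiple is zero as soon as `D_u Z` is orthogonal to `v`. The first two
lines yield this, first for `u = v` and then, as `D_v Z = 0` implies `A([ξ̂, Ŷ]) = 0`, for `u = X̂`
(`leviCivita_eq_zero_of_forall_exists_eq_smul`). The third line now determines the curvature,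
`A([X̂, Ŷ]) = -2 i σ ε g(∇_X ξ, Y)`. Its skew-symmetry says that `ξ` is a Killing field; the
remaining assertions express that `dη = 2 g(∇ξ, ·)` for Killing fields, and that adding `i σ ε η` to
a connection form adds `i σ ε dη` to its curvature (`twist_form_mlieBracket`).

Conversely, the curvature of `A₀ + i σ ε η` with `A₀` flat is `i σ ε dη`, and for a Killing field
`ξ` of constant length `∇ξ` is orthogonal to `ξ` in both arguments, so all four expressions vanish
(`leviCivita_eq_zero_of_form_mlieBracket`).
-/

/-! ### Vector fields as derivations -/

section Derivations
variable {E : Type*} [NormedAddCommGroup E] [NormedSpace ℝ E]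
  {M : Type*} [TopologicalSpace M] [ChartedSpace E M] [IsManifold 𝓘(ℝ, E) ∞ M]

theorem SmoothFieldAt.mdifferentiableAt {X : Π x : M, TangentSpace 𝓘(ℝ, E) x} {x : M}
    (hX : SmoothFieldAt X x) : MDiffAt (T% X) x :=
  ContMDiffAt.mdifferentiableAt hX (by simp)

theorem SmoothFieldAt.eventually_mdifferentiableAt {X : Π x : M, TangentSpace 𝓘(ℝ, E) x} {x : M}
    (hX : SmoothFieldAt X x) : ∀ᶠ y in nhds x, MDiffAt (T% X) y := by
  have : IsManifold 𝓘(ℝ, E) 2 M := .of_le (n := ∞) (by norm_cast)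
  have h : ContMDiffAt 𝓘(ℝ, E) 𝓘(ℝ, E).tangent 1 (T% X) x := ContMDiffAt.of_le hX (by norm_cast)
  filter_upwards [(contMDiffAt_iff_contMDiffAt_nhds (by simp)).1 h] with y hy
  exact hy.mdifferentiableAt (by simp)

theorem ContMDiffAt.eventually_mdifferentiableAt {k : M → ℝ} {x : M}
    (hk : ContMDiffAt 𝓘(ℝ, E) 𝓘(ℝ, ℝ) ∞ k x) :
    ∀ᶠ y in nhds x, MDifferentiableAt 𝓘(ℝ, E) 𝓘(ℝ, ℝ) k y := by
  have : IsManifold 𝓘(ℝ, E) 1 M := .of_le (n := ∞) (by norm_cast)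
  have h : ContMDiffAt 𝓘(ℝ, E) 𝓘(ℝ, ℝ) 1 k x := hk.of_le (by norm_cast)
  filter_upwards [(contMDiffAt_iff_contMDiffAt_nhds (by simp)).1 h] with y hy
  exact hy.mdifferentiableAt (by simp)

theorem smoothFieldAt_extend [FiniteDimensional ℝ E] {x : M} (u : TangentSpace 𝓘(ℝ, E) x) :
    SmoothFieldAt (FiberBundle.extend E u : Π x : M, TangentSpace 𝓘(ℝ, E) x) x :=
  FiberBundle.contMDiffAt_extend _ _ u

theorem exists_smoothFieldAt_eq [FiniteDimensional ℝ E] {x : M} (u : TangentSpace 𝓘(ℝ, E) x) :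
    ∃ X : Π x : M, TangentSpace 𝓘(ℝ, E) x, SmoothFieldAt X x ∧ X x = u :=
  ⟨FiberBundle.extend E u, smoothFieldAt_extend u, FiberBundle.extend_apply_self E u⟩

theorem SmoothFieldAt.mvfderiv_apply {X : Π x : M, TangentSpace 𝓘(ℝ, E) x} {x : M} {k : M → ℝ}
    (hk : ContMDiffAt 𝓘(ℝ, E) 𝓘(ℝ, ℝ) ∞ k x) (hX : SmoothFieldAt X x) :
    ContMDiffAt 𝓘(ℝ, E) 𝓘(ℝ, ℝ) ∞ (fun y ↦ mvfderiv 𝓘(ℝ, E) k y (X y)) x := by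
  have h1 := hk.mfderiv_const (m := ∞) (by simp)
  have h2 : ContMDiffAt 𝓘(ℝ, E) 𝓘(ℝ, ℝ).tangent ∞ (fun y ↦ TotalSpace.mk' ℝ
      (E := fun r : ℝ ↦ TangentSpace 𝓘(ℝ, ℝ) r) (k y) (mfderiv 𝓘(ℝ, E) 𝓘(ℝ, ℝ) k y (X y))) x :=
    ContMDiffAt.clm_apply_of_inCoordinates (b₁ := id) h1 hX hk
  exact (contMDiff_snd_tangentBundle_modelSpace ℝ 𝓘(ℝ, ℝ)).contMDiffAt.comp x h2

/-- The bracket is the commutator of derivations. The Jacobi identity for `X`, `Y` and `k • Z`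
expands, by the product rule, to this identity multiplied by `Z`. -/
theorem mvfderiv_mlieBracket [FiniteDimensional ℝ E] {X Y : Π x : M, TangentSpace 𝓘(ℝ, E) x}
    {x : M} {k : M → ℝ} (hk : ContMDiffAt 𝓘(ℝ, E) 𝓘(ℝ, ℝ) ∞ k x)
    (hX : SmoothFieldAt X x) (hY : SmoothFieldAt Y x) :
    mvfderiv 𝓘(ℝ, E) k x (mlieBracket 𝓘(ℝ, E) X Y x) =
      mvfderiv 𝓘(ℝ, E) (fun y ↦ mvfderiv 𝓘(ℝ, E) k y (Y y)) x (X x)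
        - mvfderiv 𝓘(ℝ, E) (fun y ↦ mvfderiv 𝓘(ℝ, E) k y (X y)) x (Y x) := by
  have i2 : IsManifold 𝓘(ℝ, E) 2 M := .of_le (n := ∞) (by norm_cast)
  have i3 : IsManifold 𝓘(ℝ, E) (minSmoothness ℝ 3) M := .of_le (n := ∞) (by simp; norm_cast)
  have i4 : IsManifold 𝓘(ℝ, E) ((⊤ : ℕ∞) + 1) M := .of_le (n := ∞) (by simp)
  rcases subsingleton_or_nontrivial E with hE | hE
  · have : ∀ u : TangentSpace 𝓘(ℝ, E) x, u = 0 := fun u ↦ hE.elim (α := E) u 0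
    rw [this (X x), this (Y x), this (mlieBracket 𝓘(ℝ, E) X Y x)]
    simp
  have hT : Nontrivial (TangentSpace 𝓘(ℝ, E) x) := hE
  obtain ⟨z, hz⟩ := exists_ne (0 : TangentSpace 𝓘(ℝ, E) x)
  let Z : Π x : M, TangentSpace 𝓘(ℝ, E) x := FiberBundle.extend E z
  have hZ : SmoothFieldAt Z x := smoothFieldAt_extend _
  have hZx : Z x = z := FiberBundle.extend_apply_self E z
  have bracket : ∀ {U V : Π x : M, TangentSpace 𝓘(ℝ, E) x}, SmoothFieldAt U x →
      SmoothFieldAt V x → SmoothFieldAt (mlieBracket 𝓘(ℝ, E) U V) x := by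
    intro U V hU hV
    exact ContMDiffAt.mlieBracket_vectorField (n := ⊤) (m := ⊤) hU hV (by simp)
  have hkZ : SmoothFieldAt (k • Z) x := ContMDiffAt.smul_section hk hZ
  have le2 : minSmoothness ℝ 2 ≤ ∞ := by simp; norm_cast
  have hJ := VectorField.leibniz_identity_mlieBracket_apply (ContMDiffAt.of_le hX le2)
    (ContMDiffAt.of_le hY le2) (ContMDiffAt.of_le hkZ le2)
  have hJ0 := VectorField.leibniz_identity_mlieBracket_apply (ContMDiffAt.of_le hX le2)
    (ContMDiffAt.of_le hY le2) (ContMDiffAt.of_le hZ le2)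
  have inner : ∀ {U : Π x : M, TangentSpace 𝓘(ℝ, E) x}, SmoothFieldAt U x →
      mlieBracket 𝓘(ℝ, E) U (k • Z) =ᶠ[nhds x]
        ((fun y ↦ mvfderiv 𝓘(ℝ, E) k y (U y)) • Z + k • mlieBracket 𝓘(ℝ, E) U Z) := by
    intro U hU
    filter_upwards [hk.eventually_mdifferentiableAt, hZ.eventually_mdifferentiableAt] with y h1 h2
    exact mlieBracket_smul_right h1 h2
  have outer : ∀ {U V : Π x : M, TangentSpace 𝓘(ℝ, E) x}, SmoothFieldAt U x →
      SmoothFieldAt V x → mlieBracket 𝓘(ℝ, E) U (mlieBracket 𝓘(ℝ, E) V (k • Z)) x =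
        mvfderiv 𝓘(ℝ, E) (fun y ↦ mvfderiv 𝓘(ℝ, E) k y (V y)) x (U x) • Z x
        + mvfderiv 𝓘(ℝ, E) k x (V x) • mlieBracket 𝓘(ℝ, E) U Z x
        + (mvfderiv 𝓘(ℝ, E) k x (U x) • mlieBracket 𝓘(ℝ, E) V Z x
          + k x • mlieBracket 𝓘(ℝ, E) U (mlieBracket 𝓘(ℝ, E) V Z) x) := by
    intro U V hU hV
    have hVk := hV.mvfderiv_apply hk
    have hVZ := bracket hV hZ
    rw [Filter.EventuallyEq.mlieBracket_vectorField_eq (Filter.EventuallyEq.refl _ U) (inner hV),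
      mlieBracket_add_right
        (ContMDiffAt.mdifferentiableAt (ContMDiffAt.smul_section hVk hZ) (by simp))
        (ContMDiffAt.mdifferentiableAt (ContMDiffAt.smul_section hk hVZ) (by simp)),
      mlieBracket_smul_right (hVk.mdifferentiableAt (by simp)) hZ.mdifferentiableAt,
      mlieBracket_smul_right (hk.mdifferentiableAt (by simp)) hVZ.mdifferentiableAt]
  rw [outer hX hY, outer hY hX,
    mlieBracket_smul_right (hk.mdifferentiableAt (by simp)) hZ.mdifferentiableAt, hJ0] at hJ
  rw [← sub_eq_zero]
  refine (smul_eq_zero.1 ?_).resolve_right (hZx.trans_ne hz)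
  rw [← sub_eq_zero] at hJ
  rw [← neg_eq_zero, ← hJ]
  module

/-- Tangent vectors are separated by the differentials of smooth functions. -/
theorem eq_of_forall_mvfderiv_eq [FiniteDimensional ℝ E] {x : M} {u w : TangentSpace 𝓘(ℝ, E) x}
    (h : ∀ k : M → ℝ, ContMDiffAt 𝓘(ℝ, E) 𝓘(ℝ, ℝ) ∞ k x →
      mvfderiv 𝓘(ℝ, E) k x u = mvfderiv 𝓘(ℝ, E) k x w) : u = w := by
  have i1 : IsManifold 𝓘(ℝ, E) 1 M := .of_le (n := ∞) (by norm_cast)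
  have hφ : ContMDiffAt 𝓘(ℝ, E) 𝓘(ℝ, E) ∞ (extChartAt 𝓘(ℝ, E) x) x := contMDiffAt_extChartAt
  have hinj := (isInvertible_mfderiv_extChartAt (I := 𝓘(ℝ, E)) (mem_extChartAt_source x)).injective
  -- test on the linear functionals of a chart
  refine hinj ((SeparatingDual.eq_iff_forall_dual_eq (R := ℝ) (V := E)).2 fun L ↦ ?_)
  have h1 := h (L ∘ extChartAt 𝓘(ℝ, E) x) (L.contMDiff.contMDiffAt.comp x hφ)
  have hL : MDifferentiableAt 𝓘(ℝ, E) 𝓘(ℝ, ℝ) L (extChartAt 𝓘(ℝ, E) x x) :=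
    L.differentiableAt.mdifferentiableAt
  rw [mvfderiv_comp_apply x hL (hφ.mdifferentiableAt (by simp)),
    mvfderiv_comp_apply x hL (hφ.mdifferentiableAt (by simp))] at h1
  have h2 : ∀ y : E, mvfderiv 𝓘(ℝ, E) L (extChartAt 𝓘(ℝ, E) x x) y = L y := by
    intro y
    have := (L.hasFDerivAt (x := extChartAt 𝓘(ℝ, E) x x)).hasMFDerivAt.mfderiv
    exact congrArg (fun T : E →L[ℝ] ℝ ↦ T y) this
  exact ((h2 _).symm.trans h1).trans (h2 _)

variable {F : Type*} [NormedAddCommGroup F] [NormedSpace ℝ F]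
  {N : Type*} [TopologicalSpace N] [ChartedSpace F N] [IsManifold 𝓘(ℝ, F) ∞ N]

/-- The derivative of a pulled back function along a field which is related to a field on the
target. -/
theorem mvfderiv_comp_of_related {π : N → M} {p : N} {U : Π q : N, TangentSpace 𝓘(ℝ, F) q}
    {X : Π x : M, TangentSpace 𝓘(ℝ, E) x} {k : M → ℝ}
    (hk : MDifferentiableAt 𝓘(ℝ, E) 𝓘(ℝ, ℝ) k (π p)) (hπ : MDifferentiableAt 𝓘(ℝ, F) 𝓘(ℝ, E) π p)
    (h : mfderiv 𝓘(ℝ, F) 𝓘(ℝ, E) π p (U p) = X (π p)) :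
    mvfderiv 𝓘(ℝ, F) (fun q ↦ k (π q)) p (U p) = mvfderiv 𝓘(ℝ, E) k (π p) (X (π p)) := by
  rw [← h]
  exact mvfderiv_comp_apply p hk hπ _

/-- The brackets of related fields are related. -/
theorem mfderiv_mlieBracket_of_related [FiniteDimensional ℝ E] [FiniteDimensional ℝ F] {π : N → M}
    {p : N} (hπ : ContMDiff 𝓘(ℝ, F) 𝓘(ℝ, E) ∞ π)
    {U V : Π q : N, TangentSpace 𝓘(ℝ, F) q} {X Y : Π x : M, TangentSpace 𝓘(ℝ, E) x}
    (hU : SmoothFieldAt U p) (hV : SmoothFieldAt V p) (hX : SmoothFieldAt X (π p))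
    (hY : SmoothFieldAt Y (π p))
    (hUX : ∀ q, mfderiv 𝓘(ℝ, F) 𝓘(ℝ, E) π q (U q) = X (π q))
    (hVY : ∀ q, mfderiv 𝓘(ℝ, F) 𝓘(ℝ, E) π q (V q) = Y (π q)) :
    mfderiv 𝓘(ℝ, F) 𝓘(ℝ, E) π p (mlieBracket 𝓘(ℝ, F) U V p) = mlieBracket 𝓘(ℝ, E) X Y (π p) := by
  refine eq_of_forall_mvfderiv_eq fun k hk ↦ ?_
  have hd : ∀ q, MDifferentiableAt 𝓘(ℝ, F) 𝓘(ℝ, E) π q := fun q ↦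
    hπ.contMDiffAt.mdifferentiableAt (by simp)
  have h1 : ∀ {W : Π q : N, TangentSpace 𝓘(ℝ, F) q} {Z : Π x : M, TangentSpace 𝓘(ℝ, E) x},
      (∀ q, mfderiv 𝓘(ℝ, F) 𝓘(ℝ, E) π q (W q) = Z (π q)) →
      (fun q ↦ mvfderiv 𝓘(ℝ, F) (fun q ↦ k (π q)) q (W q)) =ᶠ[nhds p]
        fun q ↦ mvfderiv 𝓘(ℝ, E) k (π q) (Z (π q)) := by
    intro W Z hWZ
    filter_upwards [hπ.continuous.continuousAt.eventually hk.eventually_mdifferentiableAt] with q hq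
    exact mvfderiv_comp_of_related hq (hd q) (hWZ q)
  have h2 := mvfderiv_mlieBracket (hk.comp p hπ.contMDiffAt) hU hV
  have h3 := mvfderiv_mlieBracket hk hX hY
  have h4 : ∀ {k₁ k₂ : N → ℝ}, k₁ =ᶠ[nhds p] k₂ → mvfderiv 𝓘(ℝ, F) k₁ p = mvfderiv 𝓘(ℝ, F) k₂ p :=
    fun h ↦ by
      have := Filter.EventuallyEq.mfderiv_eq (I := 𝓘(ℝ, F)) (I' := 𝓘(ℝ, ℝ)) h
      exact this
  rw [mvfderiv_comp_apply p (hk.mdifferentiableAt (by simp)) (hd p)] at h2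
  rw [h2, h3]
  congr 1
  · exact (congrArg (fun L : F →L[ℝ] ℝ ↦ L (U p)) (h4 (h1 hVY))).trans
      (mvfderiv_comp_of_related ((hY.mvfderiv_apply hk).mdifferentiableAt (by simp)) (hd p) (hUX p))
  · exact (congrArg (fun L : F →L[ℝ] ℝ ↦ L (V p)) (h4 (h1 hUX))).trans
      (mvfderiv_comp_of_related ((hX.mvfderiv_apply hk).mdifferentiableAt (by simp)) (hd p) (hVY p))

end Derivations

/-! ### Fundamental fields and horizontal lifts -/

section BundleFields
variable {E : Type*} [NormedAddCommGroup E] [NormedSpace ℝ E]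
  {B : Type*} [TopologicalSpace B] [ChartedSpace E B]
  {F : Type*} [NormedAddCommGroup F] [NormedSpace ℝ F]
  {P : Type*} [TopologicalSpace P] [ChartedSpace F P] [MulAction Circle P]
  [IsManifold 𝓘(ℝ, E) ∞ B] [IsManifold 𝓘(ℝ, F) ∞ P]

/-- Let `f q` be a family of maps depending smoothly on `q`, with `f q (γ q) = q`. The field whose
value at `q` is the image of `X (γ q)` under the differential of `f q` at `γ q` is smooth. -/
theorem smoothFieldAt_mfderiv_family {f : P → B → P} {γ : P → B} {p : P}
    {X : Π b : B, TangentSpace 𝓘(ℝ, E) b}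
    (hf : ContMDiffAt (𝓘(ℝ, F).prod 𝓘(ℝ, E)) 𝓘(ℝ, F) ∞ (Function.uncurry f) (p, γ p))
    (hγ : ContMDiffAt 𝓘(ℝ, F) 𝓘(ℝ, E) ∞ γ p) (hX : SmoothFieldAt X (γ p))
    (hfγ : ∀ᶠ q in nhds p, f q (γ q) = q) :
    SmoothFieldAt (M := P) (fun q ↦ (mfderiv 𝓘(ℝ, E) 𝓘(ℝ, F) (f q) (γ q) (X (γ q)) : F)) p := by
  have h1 := hf.mfderiv f γ hγ (m := ∞) (by simp)
  have h2 : ContMDiffAt 𝓘(ℝ, F) 𝓘(ℝ, F) ∞ (fun q ↦ f q (γ q)) p :=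
    contMDiffAt_id.congr_of_eventuallyEq hfγ
  have h3 : ContMDiffAt 𝓘(ℝ, F) 𝓘(ℝ, F).tangent ∞ (fun q ↦ TotalSpace.mk' F
      (E := fun r : P ↦ TangentSpace 𝓘(ℝ, F) r) (f q (γ q))
      (mfderiv 𝓘(ℝ, E) 𝓘(ℝ, F) (f q) (γ q) (X (γ q)))) p :=
    ContMDiffAt.clm_apply_of_inCoordinates (b₁ := γ) (v := fun q ↦ X (γ q)) h1
      (ContMDiffAt.comp p hX hγ) h2
  have h4 : ∀ {a b : P}, a = b → ∀ w : F, TotalSpace.mk' F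
      (E := fun r : P ↦ TangentSpace 𝓘(ℝ, F) r) b w = TotalSpace.mk' F a w := by
    rintro a _ rfl w
    rfl
  refine h3.congr_of_eventuallyEq ?_
  filter_upwards [hfγ] with q hq
  exact h4 hq _

namespace IsPrincipalCircleBundle
variable {π : P → B}

theorem isSmoothField_fundamentalField (hπ : IsPrincipalCircleBundle E F π) (a : ℝ) :
    IsSmoothField (fundamentalField F a : Π p : P, TangentSpace 𝓘(ℝ, F) p) := by
  intro p
  have h1 : ContMDiff 𝓘(ℝ, ℝ) (𝓡 1) ∞ (fun t : ℝ ↦ Circle.exp (t * a)) :=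
    contMDiff_circleExp.comp (contDiff_id.mul contDiff_const).contMDiff
  refine smoothFieldAt_mfderiv_family (B := ℝ) (f := fun q t ↦ Circle.exp (t * a) • q)
    (γ := fun _ ↦ 0) (X := fun _ ↦ (1 : ℝ)) ?_ contMDiffAt_const ?_ (by simp)
  · exact (hπ.contMDiff_smul.comp ((h1.comp contMDiff_snd).prodMk contMDiff_fst)).contMDiffAt
  · refine (Bundle.contMDiffAt_section _).2 ?_
    simpa using contMDiffAt_const

/-- A smooth field on the base has a smooth lift near each point of `P`: in a local trivialization
differentiate the sections of constant circle component. -/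
theorem exists_smoothFieldAt_lift (hπ : IsPrincipalCircleBundle E F π) {p : P}
    {X : Π b : B, TangentSpace 𝓘(ℝ, E) b} (hX : SmoothFieldAt X (π p)) :
    ∃ U : Π q : P, TangentSpace 𝓘(ℝ, F) q, SmoothFieldAt U p ∧
      ∀ᶠ q in nhds p, mfderiv 𝓘(ℝ, F) 𝓘(ℝ, E) π q (U q) = X (π q) := by
  obtain ⟨e, hb, he, hes, -⟩ := hπ.exists_trivialization (π p)
  have hsource : ∀ {q}, π q ∈ e.baseSet → q ∈ e.source := fun hq ↦ by rwa [e.source_eq]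
  have hmem : ∀ {b c}, b ∈ e.baseSet → (b, c) ∈ e.target := fun hb ↦ by
    rw [e.target_eq]; exact ⟨hb, trivial⟩
  let f : P → B → P := fun q b ↦ e.toOpenPartialHomeomorph.symm (b, (e q).2)
  have hnear : ∀ᶠ q in nhds p, π q ∈ e.baseSet :=
    hπ.contMDiff_proj.continuous.continuousAt.eventually (e.open_baseSet.mem_nhds hb)
  have hfπ : ∀ {q}, π q ∈ e.baseSet → f q (π q) = q := fun {q} hq ↦ by
    have : (π q, (e q).2) = e q := Prod.ext (e.proj_toFun q (hsource hq)).symm rfl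
    simp only [f, this]
    exact e.toOpenPartialHomeomorph.left_inv (hsource hq)
  have hf : ContMDiffAt (𝓘(ℝ, F).prod 𝓘(ℝ, E)) 𝓘(ℝ, F) ∞ (Function.uncurry f) (p, π p) := by
    have h1 := hes.contMDiffAt (e.open_target.mem_nhds (hmem hb (c := (e p).2)))
    have h2 := he.contMDiffAt (e.open_source.mem_nhds (hsource hb))
    have h3 : ContMDiffAt (𝓘(ℝ, F).prod 𝓘(ℝ, E)) (𝓘(ℝ, E).prod (𝓡 1)) ∞
        (fun x : P × B ↦ (x.2, (e x.1).2)) (p, π p) :=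
      contMDiffAt_snd.prodMk (ContMDiffAt.comp (f := Prod.fst) (p, π p) h2 contMDiffAt_fst).snd
    exact ContMDiffAt.comp (p, π p) h1 h3
  refine ⟨_, smoothFieldAt_mfderiv_family (X := X) hf hπ.contMDiff_proj.contMDiffAt hX
    (hnear.mono fun q ↦ hfπ), ?_⟩
  filter_upwards [hnear] with q hq
  have hd : MDifferentiableAt 𝓘(ℝ, E) 𝓘(ℝ, F) (f q) (π q) := by
    have h1 := (hes.contMDiffAt (e.open_target.mem_nhds
      (hmem hq (c := (e q).2)))).mdifferentiableAt (by simp)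
    exact h1.comp (π q) (mdifferentiableAt_id.prodMk mdifferentiableAt_const)
  have hid : (fun b ↦ π (f q b)) =ᶠ[nhds (π q)] id := by
    filter_upwards [e.open_baseSet.mem_nhds hq] with b hb
    have h1 := e.proj_toFun _ (e.toOpenPartialHomeomorph.map_target (hmem hb (c := (e q).2)))
    rw [e.toOpenPartialHomeomorph.right_inv (hmem hb)] at h1
    exact h1.symm
  have h1 : ∀ r, r = q →
      HasMFDerivAt 𝓘(ℝ, F) 𝓘(ℝ, E) π r (mfderiv 𝓘(ℝ, F) 𝓘(ℝ, E) π q : F →L[ℝ] E) := by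
    rintro _ rfl
    exact (hπ.mdifferentiableAt_proj _).hasMFDerivAt
  have h2 := ((h1 _ (hfπ hq)).comp (π q) hd.hasMFDerivAt).congr_of_eventuallyEq hid.symm
  have h3 := hasMFDerivAt_unique h2 (hasMFDerivAt_id (π q))
  exact congrArg (fun L : E →L[ℝ] E ↦ L (X (π q))) h3

theorem eq_horizontalLift (hπ : IsPrincipalCircleBundle E F π) (A : ConnectionForm F P)
    {X : Π b : B, TangentSpace 𝓘(ℝ, E) b} {p : P} {u : TangentSpace 𝓘(ℝ, F) p}
    (hA : A.form p u = 0) (hu : mfderiv 𝓘(ℝ, F) 𝓘(ℝ, E) π p u = X (π p)) :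
    u = hπ.horizontalLift A X p := by
  rw [← sub_eq_zero]
  refine hπ.eq_zero_of_vertical_of_form_eq_zero A ?_ ?_
  · rw [map_sub, hu, hπ.mfderiv_horizontalLift, sub_self]
  · rw [map_sub, hA, hπ.form_horizontalLift, sub_self]

theorem form_eq_im_mul_I (A : ConnectionForm F P) {p : P} (u : TangentSpace 𝓘(ℝ, F) p) :
    A.form p u = (A.form p u).im * Complex.I := by
  apply Complex.ext <;> simp [A.re_eq_zero]

theorem smoothFieldAt_horizontalLift (hπ : IsPrincipalCircleBundle E F π) (A : ConnectionForm F P)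
    {X : Π b : B, TangentSpace 𝓘(ℝ, E) b} {p : P} (hX : SmoothFieldAt X (π p)) :
    SmoothFieldAt (hπ.horizontalLift A X) p := by
  obtain ⟨U, hU, hUX⟩ := hπ.exists_smoothFieldAt_lift hX
  have him : ContMDiffAt 𝓘(ℝ, F) 𝓘(ℝ, ℝ) ∞ (fun q ↦ (A.form q (U q)).im) p :=
    Complex.imCLM.contMDiff.contMDiffAt.comp p (contMDiffAt_form A hU)
  have h : SmoothFieldAt (fun q ↦ U q - (A.form q (U q)).im • fundamentalField F 1 q) p :=
    ContMDiffAt.sub_section hU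
      (ContMDiffAt.smul_section him (hπ.isSmoothField_fundamentalField 1 p))
  refine ContMDiffAt.congr_of_eventuallyEq h ?_
  filter_upwards [hUX] with q hq
  congr 1
  refine (hπ.eq_horizontalLift A ?_ ?_).symm
  · rw [map_sub, map_smul, A.fundamental, form_eq_im_mul_I A (U q)]
    simp
  · rw [map_sub, map_smul, hπ.mfderiv_proj_fundamentalField, smul_zero, sub_zero, hq]

/-- Every tangent vector of `P` is the sum of a horizontal lift and a multiple of the vertical
field. -/
theorem eq_horizontalLift_add (hπ : IsPrincipalCircleBundle E F π) (A : ConnectionForm F P)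
    {X : Π b : B, TangentSpace 𝓘(ℝ, E) b} {p : P} {u : TangentSpace 𝓘(ℝ, F) p}
    (hu : mfderiv 𝓘(ℝ, F) 𝓘(ℝ, E) π p u = X (π p)) :
    u = hπ.horizontalLift A X p + (A.form p u).im • fundamentalField F 1 p := by
  rw [← sub_eq_iff_eq_add]
  refine hπ.eq_horizontalLift A ?_ ?_
  · rw [map_sub, map_smul, A.fundamental, form_eq_im_mul_I A u]
    simp
  · rw [map_sub, map_smul, hπ.mfderiv_proj_fundamentalField, smul_zero, sub_zero, hu]

theorem mdifferentiableAt_smul (hπ : IsPrincipalCircleBundle E F π) (z : Circle) (p : P) :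
    MDifferentiableAt 𝓘(ℝ, F) 𝓘(ℝ, F) (fun q : P ↦ z • q) p :=
  (hπ.contMDiff_smul.comp (contMDiff_const.prodMk contMDiff_id)).contMDiffAt.mdifferentiableAt
    (by simp)

theorem mfderiv_proj_smul (hπ : IsPrincipalCircleBundle E F π) (z : Circle) (p : P)
    (u : TangentSpace 𝓘(ℝ, F) p) :
    (mfderiv 𝓘(ℝ, F) 𝓘(ℝ, E) π (z • p) (mfderiv 𝓘(ℝ, F) 𝓘(ℝ, F) (fun q : P ↦ z • q) p u) : E) =
      mfderiv 𝓘(ℝ, F) 𝓘(ℝ, E) π p u := by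
  have h1 := mfderiv_comp_apply p (hπ.mdifferentiableAt_proj (z • p))
    (hπ.mdifferentiableAt_smul z p) u
  have h2 : π ∘ (fun q : P ↦ z • q) = π := funext (hπ.proj_smul z)
  have h3 : ∀ k : P → B, k = π → (mfderiv 𝓘(ℝ, F) 𝓘(ℝ, E) k p : F →L[ℝ] E) u =
      (mfderiv 𝓘(ℝ, F) 𝓘(ℝ, E) π p : F →L[ℝ] E) u := by
    rintro _ rfl
    rfl
  exact h1.symm.trans (h3 _ h2)

/-- Horizontal lifts are invariant under the action. -/
theorem horizontalLift_smul (hπ : IsPrincipalCircleBundle E F π) (A : ConnectionForm F P)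
    (X : Π b : B, TangentSpace 𝓘(ℝ, E) b) (z : Circle) (p : P) :
    hπ.horizontalLift A X (z • p) =
      mfderiv 𝓘(ℝ, F) 𝓘(ℝ, F) (fun q : P ↦ z • q) p (hπ.horizontalLift A X p) := by
  refine (hπ.eq_horizontalLift A ?_ ?_).symm
  · rw [A.invariant, hπ.form_horizontalLift]
  · exact (hπ.mfderiv_proj_smul z p _).trans ((hπ.mfderiv_horizontalLift A X p).trans
      (congrArg (fun b ↦ (X b : E)) (hπ.proj_smul z p).symm))

end IsPrincipalCircleBundle
end BundleFields

/-! ### Brackets of fundamental fields and horizontal lifts -/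

section BundleBrackets
variable {E : Type*} [NormedAddCommGroup E] [NormedSpace ℝ E] [FiniteDimensional ℝ E]
  {B : Type*} [TopologicalSpace B] [ChartedSpace E B] [IsManifold 𝓘(ℝ, E) ∞ B]
  {F : Type*} [NormedAddCommGroup F] [NormedSpace ℝ F] [FiniteDimensional ℝ F]
  {P : Type*} [TopologicalSpace P] [ChartedSpace F P] [IsManifold 𝓘(ℝ, F) ∞ P]
  [MulAction Circle P]

namespace IsPrincipalCircleBundle
variable {π : P → B}

theorem mfderiv_mlieBracket_horizontalLift (hπ : IsPrincipalCircleBundle E F π)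
    (A : ConnectionForm F P) {X Y : Π b : B, TangentSpace 𝓘(ℝ, E) b} {p : P}
    (hX : SmoothFieldAt X (π p)) (hY : SmoothFieldAt Y (π p)) :
    mfderiv 𝓘(ℝ, F) 𝓘(ℝ, E) π p
        (mlieBracket 𝓘(ℝ, F) (hπ.horizontalLift A X) (hπ.horizontalLift A Y) p) =
      mlieBracket 𝓘(ℝ, E) X Y (π p) :=
  mfderiv_mlieBracket_of_related hπ.contMDiff_proj (hπ.smoothFieldAt_horizontalLift A hX)
    (hπ.smoothFieldAt_horizontalLift A hY) hX hY (hπ.mfderiv_horizontalLift A X)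
    (hπ.mfderiv_horizontalLift A Y)

/-- A differentiable function on `P` whose restriction to the orbit of `p` is constant is annihilated
by the vertical field at `p`. -/
theorem mvfderiv_fundamentalField_eq_zero (hπ : IsPrincipalCircleBundle E F π) {k : P → ℝ} {p : P}
    (hk : MDifferentiableAt 𝓘(ℝ, F) 𝓘(ℝ, ℝ) k p) (h : ∀ z : Circle, k (z • p) = k p) (a : ℝ) :
    mvfderiv 𝓘(ℝ, F) k p (fundamentalField F a p) = 0 := by
  have h1 := (hπ.mdifferentiableAt_comp_orbit a p hk).2
  have h2 : HasMFDerivAt 𝓘(ℝ, ℝ) 𝓘(ℝ, ℝ) (fun t : ℝ ↦ k (Circle.exp (t * a) • p)) 0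
      (0 : ℝ →L[ℝ] ℝ) :=
    (hasMFDerivAt_const (k p) (0 : ℝ)).congr_of_eventuallyEq
      (Filter.Eventually.of_forall fun t ↦ h _)
  exact h1.symm.trans (congrArg (fun L : ℝ →L[ℝ] ℝ ↦ L 1) h2.mfderiv)

/-- Horizontal lifts are invariant, so they commute with the vertical field. In a local
trivialization let `ζ` be the circle component and `k c = Re (c ζ)`. The vertical field maps `k c`
to `k (c i)`, and by invariance it maps `X̂ (k c)` to `X̂ (k (c i))`; so the bracket, which is
vertical, annihilates all `k c`. -/
theorem mlieBracket_fundamentalField_horizontalLift (hπ : IsPrincipalCircleBundle E F π)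
    (A : ConnectionForm F P) {X : Π b : B, TangentSpace 𝓘(ℝ, E) b} {p : P}
    (hX : SmoothFieldAt X (π p)) :
    mlieBracket 𝓘(ℝ, F) (fundamentalField F 1) (hπ.horizontalLift A X) p = 0 := by
  have hv : SmoothFieldAt (fundamentalField F 1) p := hπ.isSmoothField_fundamentalField 1 p
  have hXl := hπ.smoothFieldAt_horizontalLift A hX
  have hvert : mfderiv 𝓘(ℝ, F) 𝓘(ℝ, E) π p
      (mlieBracket 𝓘(ℝ, F) (fundamentalField F 1) (hπ.horizontalLift A X) p) = 0 := by
    have h0 : SmoothFieldAt (0 : Π b : B, TangentSpace 𝓘(ℝ, E) b) (π p) :=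
      (Bundle.contMDiff_zeroSection ℝ (fun b : B ↦ TangentSpace 𝓘(ℝ, E) b)).contMDiffAt
    rw [mfderiv_mlieBracket_of_related hπ.contMDiff_proj hv hXl h0 hX
      (fun q ↦ hπ.mfderiv_proj_fundamentalField 1 q) (hπ.mfderiv_horizontalLift A X),
      VectorField.mlieBracket_zero_left]
    rfl
  obtain ⟨r, hr⟩ := hπ.exists_eq_smul_fundamentalField p _ hvert
  obtain ⟨e, hb, he, -, hequiv⟩ := hπ.exists_trivialization (π p)
  have hp : p ∈ e.source := by rwa [e.source_eq]
  have hmem : ∀ {q}, q ∈ e.source → ∀ z : Circle, z • q ∈ e.source := fun hq z ↦ by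
    rw [e.source_eq, Set.mem_preimage] at hq ⊢
    rwa [hπ.proj_smul]
  let ζ : P → ℂ := fun q ↦ ((e q).2 : ℂ)
  have hζ : ∀ {q}, q ∈ e.source → ∀ z : Circle, ζ (z • q) = z * ζ q := fun hq z ↦ by
    simp only [ζ, hequiv _ hq, Circle.coe_mul]
  have hζs : ∀ {q}, q ∈ e.source → ContMDiffAt 𝓘(ℝ, F) 𝓘(ℝ, ℂ) ∞ ζ q := fun {q} hq ↦ by
    have : Fact (Module.finrank ℝ ℂ = 1 + 1) := Complex.finrank_real_complex_fact
    have hco : ContMDiff (𝓡 1) 𝓘(ℝ, ℂ) ∞ (fun z : Circle ↦ (z : ℂ)) := contMDiff_coe_sphere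
    exact hco.contMDiffAt.comp q (he.contMDiffAt (e.open_source.mem_nhds hq)).snd
  let k : ℂ → P → ℝ := fun c q ↦ (c * ζ q).re
  have hk : ∀ c {q}, q ∈ e.source → ContMDiffAt 𝓘(ℝ, F) 𝓘(ℝ, ℝ) ∞ (k c) q := fun c q hq ↦
    (Complex.reCLM.comp ((ContinuousLinearMap.mul ℝ ℂ) c)).contMDiff.contMDiffAt.comp q (hζs hq)
  have hkd : ∀ c {q}, q ∈ e.source → MDifferentiableAt 𝓘(ℝ, F) 𝓘(ℝ, ℝ) (k c) q := fun c q hq ↦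
    (hk c hq).mdifferentiableAt (by simp)
  -- the derivative at zero of a real linear function of `c * exp (t i)`
  have hderiv : ∀ (c : ℂ) (α β : ℝ), (mfderiv 𝓘(ℝ, ℝ) 𝓘(ℝ, ℝ)
      (fun t : ℝ ↦ (c * Circle.exp (t * 1)).re * α + (c * Circle.exp (t * 1)).im * β) 0 :
        ℝ →L[ℝ] ℝ) 1 = (c * Complex.I).re * α + (c * Complex.I).im * β := by
    intro c α β
    have h1 : HasDerivAt (fun t : ℝ ↦ c * (Circle.exp (t * 1) : ℂ)) (c * Complex.I) 0 := by
      have := ((Complex.ofRealCLM.hasDerivAt (x := 0)).mul_const Complex.I).cexp.const_mul c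
      simpa using this
    have h2 := ((Complex.reCLM.hasFDerivAt.comp_hasDerivAt (0 : ℝ) h1).mul_const α).add
      ((Complex.imCLM.hasFDerivAt.comp_hasDerivAt (0 : ℝ) h1).mul_const β)
    have h3 := congrArg (fun L : ℝ →L[ℝ] ℝ ↦ L 1) h2.hasFDerivAt.hasMFDerivAt.mfderiv
    refine h3.trans ?_
    simp
  have hvk : ∀ c {q}, q ∈ e.source →
      mvfderiv 𝓘(ℝ, F) (k c) q (fundamentalField F 1 q) = k (c * Complex.I) q := by
    intro c q hq
    have h1 := (hπ.mdifferentiableAt_comp_orbit 1 q (hkd c hq)).2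
    refine h1.symm.trans (Eq.trans ?_ ((hderiv c (ζ q).re (-(ζ q).im)).trans ?_))
    · congr 2
      funext t
      simp only [k, hζ hq, ← mul_assoc]
      rw [Complex.mul_re]
      ring
    · have h2 : (c * Complex.I).re * (ζ q).re + (c * Complex.I).im * (-(ζ q).im) =
          (c * Complex.I * ζ q).re := by
        rw [Complex.mul_re (c * Complex.I)]
        ring
      exact h2
  have hlin : ∀ (c : ℂ) (u : TangentSpace 𝓘(ℝ, F) p), mvfderiv 𝓘(ℝ, F) (k c) p u =
      c.re * mvfderiv 𝓘(ℝ, F) (k 1) p u + c.im * mvfderiv 𝓘(ℝ, F) (k Complex.I) p u := by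
    intro c u
    have h1 : k c = fun q ↦ c.re * k 1 q + c.im * k Complex.I q := by
      funext q
      simp [k, Complex.mul_re]
      ring
    have h2 : ∀ (a : ℝ) (d : ℂ), MDifferentiableAt 𝓘(ℝ, F) 𝓘(ℝ, ℝ) (fun q ↦ a * k d q) p :=
      fun a d ↦ ((contMDiffAt_const (c := a)).mul (hk d hp)).mdifferentiableAt (by simp)
    rw [h1, mvfderiv_fun_add (h2 _ _) (h2 _ _), mvfderiv_fun_mul mdifferentiableAt_const (hkd 1 hp),
      mvfderiv_fun_mul mdifferentiableAt_const (hkd Complex.I hp)]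
    simp [mvfderiv_const]
  have hXk : ∀ (c : ℂ) (z : Circle),
      mvfderiv 𝓘(ℝ, F) (k c) (z • p) (hπ.horizontalLift A X (z • p)) =
        mvfderiv 𝓘(ℝ, F) (k (c * z)) p (hπ.horizontalLift A X p) := by
    intro c z
    rw [hπ.horizontalLift_smul]
    refine (mvfderiv_comp_apply p (hkd c (hmem hp z))
      (hπ.mdifferentiableAt_smul z p) _).symm.trans ?_
    have h1 : (k c ∘ fun q ↦ z • q) =ᶠ[nhds p] k (c * z) := by
      filter_upwards [e.open_source.mem_nhds hp] with q hq
      simp only [Function.comp, k, hζ hq, mul_assoc]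
    exact congrArg (fun L : F →L[ℝ] ℝ ↦ L (hπ.horizontalLift A X p))
      (Filter.EventuallyEq.mfderiv_eq (I := 𝓘(ℝ, F)) (I' := 𝓘(ℝ, ℝ)) h1)
  have hvX : ∀ c, mvfderiv 𝓘(ℝ, F)
      (fun q ↦ mvfderiv 𝓘(ℝ, F) (k c) q (hπ.horizontalLift A X q)) p (fundamentalField F 1 p) =
        mvfderiv 𝓘(ℝ, F) (k (c * Complex.I)) p (hπ.horizontalLift A X p) := by
    intro c
    have h1 := (hπ.mdifferentiableAt_comp_orbit 1 p
      ((hXl.mvfderiv_apply (hk c hp)).mdifferentiableAt (by simp))).2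
    refine h1.symm.trans (Eq.trans ?_ ((hderiv c _ _).trans (hlin (c * Complex.I) _).symm))
    congr 2
    funext t
    rw [hXk, hlin]
  have hzero : ∀ c, mvfderiv 𝓘(ℝ, F) (k c) p
      (mlieBracket 𝓘(ℝ, F) (fundamentalField F 1) (hπ.horizontalLift A X) p) = 0 := by
    intro c
    rw [mvfderiv_mlieBracket (hk c hp) hv hXl, hvX, sub_eq_zero]
    have h1 : k (c * Complex.I) =ᶠ[nhds p]
        fun q ↦ mvfderiv 𝓘(ℝ, F) (k c) q (fundamentalField F 1 q) := by
      filter_upwards [e.open_source.mem_nhds hp] with q hq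
      exact (hvk c hq).symm
    exact congrArg (fun L : F →L[ℝ] ℝ ↦ L (hπ.horizontalLift A X p))
      (Filter.EventuallyEq.mfderiv_eq (I := 𝓘(ℝ, F)) (I' := 𝓘(ℝ, ℝ)) h1)
  -- the test function `k c` with `k (c * i) p = 1`
  have h1 := hzero (-Complex.I * (starRingEnd ℂ) (ζ p))
  rw [hr, map_smul, hvk _ hp] at h1
  have h2 : k (-Complex.I * (starRingEnd ℂ) (ζ p) * Complex.I) p = 1 := by
    have h3 : -Complex.I * (starRingEnd ℂ) (ζ p) * Complex.I * ζ p =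
        -(Complex.I * Complex.I) * ((starRingEnd ℂ) (ζ p) * ζ p) := by ring
    simp only [k]
    rw [h3, Complex.I_mul_I, Complex.conj_mul', show ‖ζ p‖ = 1 from Circle.norm_coe _]
    simp
  rw [h2, smul_eq_mul, mul_one] at h1
  rw [hr, h1, zero_smul]

end IsPrincipalCircleBundle
end BundleBrackets

/-! ### Killing fields and the exterior derivative -/

section Killing
variable {E : Type*} [NormedAddCommGroup E] [NormedSpace ℝ E] [FiniteDimensional ℝ E]
  {M : Type*} [TopologicalSpace M] [ChartedSpace E M] [IsManifold 𝓘(ℝ, E) ∞ M]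

namespace PseudoRiemannianMetric
variable (g : PseudoRiemannianMetric E M)

theorem exteriorDerivative_inner {ξ X Y : Π x : M, TangentSpace 𝓘(ℝ, E) x} {x : M}
    (hξ : SmoothFieldAt ξ x) (hX : SmoothFieldAt X x) (hY : SmoothFieldAt Y x) :
    exteriorDerivative (fun y ↦ g.inner y (ξ y)) X Y x =
      g.inner x (g.leviCivita ξ x (X x)) (Y x) - g.inner x (g.leviCivita ξ x (Y x)) (X x) := by
  rw [exteriorDerivative,
    g.leviCivita_metric hX.mdifferentiableAt hξ.mdifferentiableAt hY.mdifferentiableAt,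
    g.leviCivita_metric hY.mdifferentiableAt hξ.mdifferentiableAt hX.mdifferentiableAt,
    ← g.leviCivita_torsion_free hX.mdifferentiableAt hY.mdifferentiableAt]
  simp only [map_sub]
  ring

/-- A smooth field is a Killing field if and only if its covariant derivative is skew-symmetric. -/
theorem isKilling_iff {ξ : Π x : M, TangentSpace 𝓘(ℝ, E) x} :
    g.IsKilling ξ ↔ IsSmoothField ξ ∧ ∀ (x : M) (u w : TangentSpace 𝓘(ℝ, E) x),
      g.inner x (g.leviCivita ξ x u) w = -g.inner x (g.leviCivita ξ x w) u := by
  have key : ∀ {x : M} {Y Z : Π x : M, TangentSpace 𝓘(ℝ, E) x}, SmoothFieldAt ξ x →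
      SmoothFieldAt Y x → SmoothFieldAt Z x →
      (mvfderiv 𝓘(ℝ, E) (fun y ↦ g.inner y (Y y) (Z y)) x (ξ x) =
        g.inner x (mlieBracket 𝓘(ℝ, E) ξ Y x) (Z x) + g.inner x (Y x) (mlieBracket 𝓘(ℝ, E) ξ Z x) ↔
      g.inner x (g.leviCivita ξ x (Y x)) (Z x) = -g.inner x (g.leviCivita ξ x (Z x)) (Y x)) := by
    intro x Y Z hξ hY hZ
    rw [g.leviCivita_metric hξ.mdifferentiableAt hY.mdifferentiableAt hZ.mdifferentiableAt,
      ← g.leviCivita_torsion_free hξ.mdifferentiableAt hY.mdifferentiableAt,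
      ← g.leviCivita_torsion_free hξ.mdifferentiableAt hZ.mdifferentiableAt]
    simp only [map_sub, sub_apply, g.symm x (Y x)]
    constructor <;> intro h <;> linarith
  refine ⟨fun h ↦ ⟨h.1, fun x u w ↦ ?_⟩, fun h ↦ ⟨h.1, fun x Y Z hY hZ ↦ ?_⟩⟩
  · obtain ⟨Y, hY, rfl⟩ := exists_smoothFieldAt_eq u
    obtain ⟨Z, hZ, rfl⟩ := exists_smoothFieldAt_eq w
    exact (key (h.1 x) hY hZ).1 (h.2 x Y Z hY hZ)
  · exact (key (h.1 x) hY hZ).2 (h.2 x _ _)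

/-- A field of constant length is orthogonal to its covariant derivatives. -/
theorem inner_leviCivita_self {ξ : Π x : M, TangentSpace 𝓘(ℝ, E) x} {c : ℝ} {x : M}
    (hξ : SmoothFieldAt ξ x) (hc : ∀ y, g.inner y (ξ y) (ξ y) = c)
    (u : TangentSpace 𝓘(ℝ, E) x) : g.inner x (g.leviCivita ξ x u) (ξ x) = 0 := by
  obtain ⟨X, hX, rfl⟩ := exists_smoothFieldAt_eq u
  have h := g.leviCivita_metric hX.mdifferentiableAt hξ.mdifferentiableAt hξ.mdifferentiableAt
  simp only [hc, mvfderiv_const, zero_apply, g.symm x (ξ x)] at h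
  linarith

end PseudoRiemannianMetric
end Killing

/-! ### The Levi-Civita derivative of a Kaluza-Klein metric -/

section KaluzaKlein
variable {E : Type*} [NormedAddCommGroup E] [NormedSpace ℝ E] [FiniteDimensional ℝ E]
  {B : Type*} [TopologicalSpace B] [ChartedSpace E B] [IsManifold 𝓘(ℝ, E) ∞ B]
  {F : Type*} [NormedAddCommGroup F] [NormedSpace ℝ F] [FiniteDimensional ℝ F]
  {P : Type*} [TopologicalSpace P] [ChartedSpace F P] [IsManifold 𝓘(ℝ, F) ∞ P]
  [MulAction Circle P]

namespace IsPrincipalCircleBundle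
variable {π : P → B} (hπ : IsPrincipalCircleBundle E F π) (g : PseudoRiemannianMetric E B)
  (A : ConnectionForm F P) {σ : ℝ} (hσ : σ = 1 ∨ σ = -1)
  {X Y Z : Π b : B, TangentSpace 𝓘(ℝ, E) b} {p : P}

theorem kaluzaKlein_inner (u w : TangentSpace 𝓘(ℝ, F) p) :
    (hπ.kaluzaKlein g A σ hσ).inner p u w =
      g.inner (π p) (mfderiv 𝓘(ℝ, F) 𝓘(ℝ, E) π p u) (mfderiv 𝓘(ℝ, F) 𝓘(ℝ, E) π p w)
        + σ * (A.form p u * A.form p w).re := rfl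

theorem kaluzaKlein_inner_horizontalLift (u : TangentSpace 𝓘(ℝ, F) p) :
    (hπ.kaluzaKlein g A σ hσ).inner p u (hπ.horizontalLift A Y p) =
      g.inner (π p) (mfderiv 𝓘(ℝ, F) 𝓘(ℝ, E) π p u) (Y (π p)) := by
  rw [kaluzaKlein_inner, hπ.form_horizontalLift, hπ.mfderiv_horizontalLift]
  simp

theorem kaluzaKlein_inner_fundamentalField (u : TangentSpace 𝓘(ℝ, F) p) :
    (hπ.kaluzaKlein g A σ hσ).inner p u (fundamentalField F 1 p) = -σ * (A.form p u).im := by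
  rw [kaluzaKlein_inner, hπ.mfderiv_proj_fundamentalField, A.fundamental]
  simp

theorem im_form_fundamentalField : (A.form p (fundamentalField F 1 p)).im = 1 := by
  simp [A.fundamental]

theorem mlieBracket_horizontalLift_fundamentalField (hX : SmoothFieldAt X (π p)) :
    mlieBracket 𝓘(ℝ, F) (hπ.horizontalLift A X) (fundamentalField F 1) p = 0 := by
  rw [mlieBracket_swap_apply, hπ.mlieBracket_fundamentalField_horizontalLift A hX, neg_zero]

theorem mvfderiv_inner_comp_proj_fundamentalField (hπ : IsPrincipalCircleBundle E F π)
    (hX : SmoothFieldAt X (π p))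
    (hY : SmoothFieldAt Y (π p)) :
    mvfderiv 𝓘(ℝ, F) (fun q ↦ g.inner (π q) (X (π q)) (Y (π q))) p
      (fundamentalField F 1 p) = 0 := by
  have h := g.mdifferentiableAt_inner hX.mdifferentiableAt hY.mdifferentiableAt
  refine hπ.mvfderiv_fundamentalField_eq_zero (h.comp p (hπ.mdifferentiableAt_proj p))
    (fun z ↦ ?_) 1
  exact congrArg (fun b ↦ g.inner b (X b) (Y b)) (hπ.proj_smul z p)

theorem mvfderiv_inner_comp_proj_horizontalLift (hX : SmoothFieldAt X (π p))
    (hY : SmoothFieldAt Y (π p)) :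
    mvfderiv 𝓘(ℝ, F) (fun q ↦ g.inner (π q) (X (π q)) (Y (π q))) p (hπ.horizontalLift A Z p) =
      mvfderiv 𝓘(ℝ, E) (fun b ↦ g.inner b (X b) (Y b)) (π p) (Z (π p)) :=
  mvfderiv_comp_of_related (k := fun b ↦ g.inner b (X b) (Y b))
    (g.mdifferentiableAt_inner hX.mdifferentiableAt hY.mdifferentiableAt)
    (hπ.mdifferentiableAt_proj p) (hπ.mfderiv_horizontalLift A Z p)

theorem koszul_horizontalLift_horizontalLift_horizontalLift (hX : SmoothFieldAt X (π p))
    (hY : SmoothFieldAt Y (π p)) (hZ : SmoothFieldAt Z (π p)) :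
    (hπ.kaluzaKlein g A σ hσ).koszul (hπ.horizontalLift A X) (hπ.horizontalLift A Y)
      (hπ.horizontalLift A Z) p = g.koszul X Y Z (π p) := by
  simp only [PseudoRiemannianMetric.koszul, kaluzaKlein_inner_horizontalLift,
    hπ.mfderiv_horizontalLift,
    hπ.mvfderiv_inner_comp_proj_horizontalLift g A hX hY,
    hπ.mvfderiv_inner_comp_proj_horizontalLift g A hX hZ,
    hπ.mvfderiv_inner_comp_proj_horizontalLift g A hY hZ,
    hπ.mfderiv_mlieBracket_horizontalLift A hX hY, hπ.mfderiv_mlieBracket_horizontalLift A hX hZ,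
    hπ.mfderiv_mlieBracket_horizontalLift A hY hZ]

theorem koszul_horizontalLift_horizontalLift_fundamentalField (hX : SmoothFieldAt X (π p))
    (hY : SmoothFieldAt Y (π p)) :
    (hπ.kaluzaKlein g A σ hσ).koszul (hπ.horizontalLift A X) (hπ.horizontalLift A Y)
      (fundamentalField F 1) p = -σ * (A.form p (mlieBracket 𝓘(ℝ, F) (hπ.horizontalLift A X)
        (hπ.horizontalLift A Y) p)).im := by
  simp only [PseudoRiemannianMetric.koszul, kaluzaKlein_inner_horizontalLift,
    kaluzaKlein_inner_fundamentalField, hπ.mfderiv_horizontalLift, hπ.form_horizontalLift,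
    Complex.zero_im, mul_zero, mvfderiv_const,
    hπ.mvfderiv_inner_comp_proj_fundamentalField g hX hY,
    hπ.mlieBracket_horizontalLift_fundamentalField A hX,
    hπ.mlieBracket_horizontalLift_fundamentalField A hY, map_zero, zero_apply]
  ring

theorem koszul_horizontalLift_fundamentalField_horizontalLift (hX : SmoothFieldAt X (π p))
    (hZ : SmoothFieldAt Z (π p)) :
    (hπ.kaluzaKlein g A σ hσ).koszul (hπ.horizontalLift A X) (fundamentalField F 1)
      (hπ.horizontalLift A Z) p = σ * (A.form p (mlieBracket 𝓘(ℝ, F) (hπ.horizontalLift A X)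
        (hπ.horizontalLift A Z) p)).im := by
  simp only [PseudoRiemannianMetric.koszul, kaluzaKlein_inner_horizontalLift,
    kaluzaKlein_inner_fundamentalField, hπ.mfderiv_horizontalLift, hπ.form_horizontalLift,
    hπ.mfderiv_proj_fundamentalField, Complex.zero_im, mul_zero, mvfderiv_const,
    hπ.mvfderiv_inner_comp_proj_fundamentalField g hX hZ,
    hπ.mlieBracket_horizontalLift_fundamentalField A hX,
    hπ.mlieBracket_fundamentalField_horizontalLift A hZ, map_zero, zero_apply]
  ring

theorem koszul_fundamentalField_horizontalLift_horizontalLift (hY : SmoothFieldAt Y (π p))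
    (hZ : SmoothFieldAt Z (π p)) :
    (hπ.kaluzaKlein g A σ hσ).koszul (fundamentalField F 1) (hπ.horizontalLift A Y)
      (hπ.horizontalLift A Z) p = σ * (A.form p (mlieBracket 𝓘(ℝ, F) (hπ.horizontalLift A Y)
        (hπ.horizontalLift A Z) p)).im := by
  simp only [PseudoRiemannianMetric.koszul, kaluzaKlein_inner_horizontalLift,
    kaluzaKlein_inner_fundamentalField, hπ.mfderiv_horizontalLift,
    hπ.mfderiv_proj_fundamentalField, mvfderiv_const,
    hπ.mvfderiv_inner_comp_proj_fundamentalField g hY hZ,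
    hπ.mlieBracket_fundamentalField_horizontalLift A hY,
    hπ.mlieBracket_fundamentalField_horizontalLift A hZ, map_zero, zero_apply]
  ring

theorem koszul_fundamentalField_horizontalLift_fundamentalField (hY : SmoothFieldAt Y (π p)) :
    (hπ.kaluzaKlein g A σ hσ).koszul (fundamentalField F 1) (hπ.horizontalLift A Y)
      (fundamentalField F 1) p = 0 := by
  simp only [PseudoRiemannianMetric.koszul, kaluzaKlein_inner_horizontalLift,
    kaluzaKlein_inner_fundamentalField, hπ.form_horizontalLift,
    hπ.mfderiv_proj_fundamentalField, im_form_fundamentalField, Complex.zero_im, mul_zero,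
    mvfderiv_const, hπ.mlieBracket_fundamentalField_horizontalLift A hY,
    hπ.mlieBracket_horizontalLift_fundamentalField A hY, VectorField.mlieBracket_self,
    Pi.zero_apply, map_zero, zero_apply]
  ring

theorem koszul_horizontalLift_fundamentalField_fundamentalField (hX : SmoothFieldAt X (π p)) :
    (hπ.kaluzaKlein g A σ hσ).koszul (hπ.horizontalLift A X) (fundamentalField F 1)
      (fundamentalField F 1) p = 0 := by
  simp only [PseudoRiemannianMetric.koszul,
    kaluzaKlein_inner_fundamentalField, hπ.form_horizontalLift,
    im_form_fundamentalField, Complex.zero_im, mul_zero,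
    mvfderiv_const,
    hπ.mlieBracket_horizontalLift_fundamentalField A hX, VectorField.mlieBracket_self,
    Pi.zero_apply, map_zero, zero_apply]
  ring

theorem koszul_fundamentalField_fundamentalField_horizontalLift (hX : SmoothFieldAt X (π p)) :
    (hπ.kaluzaKlein g A σ hσ).koszul (fundamentalField F 1) (fundamentalField F 1)
      (hπ.horizontalLift A X) p = 0 := by
  simp only [PseudoRiemannianMetric.koszul, kaluzaKlein_inner_horizontalLift,
    kaluzaKlein_inner_fundamentalField,
    hπ.mfderiv_proj_fundamentalField, im_form_fundamentalField, mvfderiv_const,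
    hπ.mlieBracket_fundamentalField_horizontalLift A hX, VectorField.mlieBracket_self,
    Pi.zero_apply, map_zero, zero_apply]
  ring

theorem koszul_fundamentalField_fundamentalField_fundamentalField :
    (hπ.kaluzaKlein g A σ hσ).koszul (fundamentalField F 1) (fundamentalField F 1)
      (fundamentalField F 1) p = 0 := by
  simp only [PseudoRiemannianMetric.koszul,
    kaluzaKlein_inner_fundamentalField,
    im_form_fundamentalField, mvfderiv_const, VectorField.mlieBracket_self, Pi.zero_apply, map_zero,
    zero_apply]
  ring

section LeviCivita
variable {ξ : Π b : B, TangentSpace 𝓘(ℝ, E) b} {k : P → ℝ}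

/-- The Koszul formula for a field `ξ̂ + k v` with `dk = 0`. -/
theorem two_mul_inner_leviCivita_horizontalLift_add (hξ : SmoothFieldAt ξ (π p))
    (hk : MDifferentiableAt 𝓘(ℝ, F) 𝓘(ℝ, ℝ) k p) (hdk : mvfderiv 𝓘(ℝ, F) k p = 0)
    {U W : Π q : P, TangentSpace 𝓘(ℝ, F) q} (hU : SmoothFieldAt U p) (hW : SmoothFieldAt W p) :
    2 * (hπ.kaluzaKlein g A σ hσ).inner p ((hπ.kaluzaKlein g A σ hσ).leviCivita
        (fun q ↦ hπ.horizontalLift A ξ q + k q • fundamentalField F 1 q) p (U p)) (W p) =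
      (hπ.kaluzaKlein g A σ hσ).koszul U (hπ.horizontalLift A ξ) W p
        + k p * (hπ.kaluzaKlein g A σ hσ).koszul U (fundamentalField F 1) W p := by
  have hv := (hπ.isSmoothField_fundamentalField 1 p).mdifferentiableAt (by simp)
  have hl := (hπ.smoothFieldAt_horizontalLift A hξ).mdifferentiableAt
  have hkv := hk.smul_section hv
  refine ((hπ.kaluzaKlein g A σ hσ).two_mul_inner_leviCivita hU.mdifferentiableAt
    (mdifferentiableAt_add_section hl hkv) hW.mdifferentiableAt).trans ?_
  refine ((hπ.kaluzaKlein g A σ hσ).koszul_add_mid hU.mdifferentiableAt hl hkv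
    hW.mdifferentiableAt).trans ?_
  congr 1
  refine ((hπ.kaluzaKlein g A σ hσ).koszul_smul_mid hk hU.mdifferentiableAt hv
    hW.mdifferentiableAt).trans ?_
  rw [hdk]
  simp

end LeviCivita

end IsPrincipalCircleBundle
end KaluzaKlein

/-! ### Locally constant functions and twisted connection forms -/

section OneForms
variable {E : Type*} [NormedAddCommGroup E] [NormedSpace ℝ E] [FiniteDimensional ℝ E]
  {M : Type*} [TopologicalSpace M] [ChartedSpace E M] [IsManifold 𝓘(ℝ, E) ∞ M]

/-- A field of linear forms is smooth as soon as its value on smooth fields is. -/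
theorem contMDiff_form_of_fields {G : Type*} [NormedAddCommGroup G] [NormedSpace ℝ G]
    (β : Π x : M, TangentSpace 𝓘(ℝ, E) x →L[ℝ] G)
    (h : ∀ (x : M) (X : Π x : M, TangentSpace 𝓘(ℝ, E) x), SmoothFieldAt X x →
      ContMDiffAt 𝓘(ℝ, E) 𝓘(ℝ, G) ∞ (fun y ↦ β y (X y)) x) :
    ContMDiff 𝓘(ℝ, E) (𝓘(ℝ, E).prod 𝓘(ℝ, E →L[ℝ] G)) ∞
      (fun x ↦ TotalSpace.mk' (E →L[ℝ] G)
        (E := fun x : M ↦ TangentSpace 𝓘(ℝ, E) x →L[ℝ] G) x (β x)) := by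
  intro x₀
  refine (contMDiffAt_hom_bundle (E₂ := Bundle.Trivial M G) _).2 ⟨contMDiffAt_id, ?_⟩
  let b := Module.finBasis ℝ E
  let t := trivializationAt E (fun x : M ↦ TangentSpace 𝓘(ℝ, E) x) x₀
  have hx₀ : x₀ ∈ t.baseSet := FiberBundle.mem_baseSet_trivializationAt ..
  let c (i) : E →L[ℝ] ℝ := LinearMap.toContinuousLinearMap (b.coord i)
  have key : ∀ L : E →L[ℝ] G, L = ∑ i, (c i).smulRight (L (b i)) := by
    intro L
    refine ContinuousLinearMap.coe_injective (b.ext fun i ↦ ?_)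
    simp [c, Finsupp.single_apply]
  have hs : ∀ i, ContMDiffAt 𝓘(ℝ, E) 𝓘(ℝ, E).tangent ∞ (T% (t.localFrame b i)) x₀ := fun i ↦
    contMDiffAt_localFrame_of_mem ∞ t b i hx₀
  have hsm : ContMDiffAt 𝓘(ℝ, E) 𝓘(ℝ, E →L[ℝ] G) ∞ (fun x : M ↦
      ∑ i, (c i).smulRight (β x (t.localFrame b i x))) x₀ := by
    refine ContMDiffAt.sum fun i _ ↦ ?_
    exact (ContinuousLinearMap.smulRightL ℝ E G (c i)).contMDiff.contMDiffAt.comp x₀ (h x₀ _ (hs i))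
  refine hsm.congr_of_eventuallyEq ?_
  filter_upwards [t.open_baseSet.mem_nhds hx₀] with x hx
  conv_lhs => rw [key (ContinuousLinearMap.inCoordinates _ _ _ _ _ _ _ _ _)]
  refine Finset.sum_congr rfl fun i _ ↦ ?_
  congr 1
  rw [ContinuousLinearMap.inCoordinates_eq hx (by simp)]
  simp [t, t.localFrame_apply_of_mem_baseSet b hx, Trivialization.basisAt]

theorem IsLocallyConstant.contMDiff_real {k : M → ℝ} (hk : IsLocallyConstant k) :
    ContMDiff 𝓘(ℝ, E) 𝓘(ℝ, ℝ) ∞ k := fun x ↦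
  contMDiffAt_const.congr_of_eventuallyEq (hk.eventually_eq x)

theorem IsLocallyConstant.mvfderiv_eq_zero {k : M → ℝ} (hk : IsLocallyConstant k) (x : M) :
    mvfderiv 𝓘(ℝ, E) k x = 0 := by
  have h : HasMFDerivAt 𝓘(ℝ, E) 𝓘(ℝ, ℝ) k x (0 : E →L[ℝ] ℝ) :=
    (hasMFDerivAt_const (k x) x).congr_of_eventuallyEq (hk.eventually_eq x)
  exact h.mfderiv

end OneForms

section Twist
variable {E : Type*} [NormedAddCommGroup E] [NormedSpace ℝ E] [FiniteDimensional ℝ E]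
  {B : Type*} [TopologicalSpace B] [ChartedSpace E B] [IsManifold 𝓘(ℝ, E) ∞ B]
  {F : Type*} [NormedAddCommGroup F] [NormedSpace ℝ F] [FiniteDimensional ℝ F]
  {P : Type*} [TopologicalSpace P] [ChartedSpace F P] [IsManifold 𝓘(ℝ, F) ∞ P]
  [MulAction Circle P]

namespace IsPrincipalCircleBundle
variable {π : P → B} (hπ : IsPrincipalCircleBundle E F π) (g : PseudoRiemannianMetric E B)
  (A : ConnectionForm F P) {X Y : Π b : B, TangentSpace 𝓘(ℝ, E) b} {p : P}

theorem exists_proj_eq (hπ : IsPrincipalCircleBundle E F π) (b : B) : ∃ p, π p = b := by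
  obtain ⟨e, hb, -⟩ := hπ.exists_trivialization b
  have h : (b, (1 : Circle)) ∈ e.target := by rw [e.target_eq]; exact ⟨hb, trivial⟩
  exact ⟨_, e.proj_symm_apply h⟩

theorem exists_smul_eq (hπ : IsPrincipalCircleBundle E F π) {p q : P} (h : π p = π q) :
    ∃ z : Circle, z • p = q := by
  obtain ⟨e, hb, -, -, hequiv⟩ := hπ.exists_trivialization (π p)
  have hsource : ∀ {r}, π r = π p → r ∈ e.source := fun hr ↦ by
    rw [e.source_eq, Set.mem_preimage, hr]; exact hb
  refine ⟨(e q).2 * ((e p).2)⁻¹, ?_⟩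
  have hz := hsource (hπ.proj_smul ((e q).2 * ((e p).2)⁻¹) p)
  refine e.toOpenPartialHomeomorph.injOn hz (hsource h.symm) (Prod.ext ?_ ?_)
  · exact (e.proj_toFun _ hz).trans ((hπ.proj_smul _ _).trans
      (h.trans (e.proj_toFun q (hsource h.symm)).symm))
  · exact (hequiv p (hsource rfl) _).trans (inv_mul_cancel_right _ _)

/-- A locally constant function on `P` is constant along the fibres, as these are orbits of the
connected group `S¹`; and it descends to a locally constant function, as `π` has local sections. -/
theorem exists_isLocallyConstant_comp_proj (hπ : IsPrincipalCircleBundle E F π) {k : P → ℝ}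
    (hk : IsLocallyConstant k) : ∃ ε : B → ℝ, IsLocallyConstant ε ∧ ∀ p, k p = ε (π p) := by
  choose s hs using hπ.exists_proj_eq
  have hsmul : ∀ (z : Circle) (p : P), k (z • p) = k p := by
    intro z p
    have hc : Continuous fun z : Circle ↦ z • p :=
      hπ.contMDiff_smul.continuous.comp (continuous_id.prodMk continuous_const)
    simpa using (hk.comp_continuous hc).apply_eq_of_isPreconnected isPreconnected_univ
      (Set.mem_univ z) (Set.mem_univ 1)
  have hfib : ∀ {p q}, π p = π q → k p = k q := fun h ↦ by
    obtain ⟨z, rfl⟩ := hπ.exists_smul_eq h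
    exact (hsmul z _).symm
  refine ⟨fun b ↦ k (s b), (IsLocallyConstant.iff_eventually_eq _).2 fun b ↦ ?_,
    fun p ↦ hfib (hs (π p)).symm⟩
  obtain ⟨e, hb, -⟩ := hπ.exists_trivialization b
  have hmem : ∀ {b'}, b' ∈ e.baseSet → (b', (1 : Circle)) ∈ e.target := fun hb ↦ by
    rw [e.target_eq]; exact ⟨hb, trivial⟩
  have hcont : ContinuousAt (fun b' ↦ e.toOpenPartialHomeomorph.symm (b', (1 : Circle))) b :=
    ContinuousAt.comp (f := fun b' : B ↦ (b', (1 : Circle)))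
      (e.toOpenPartialHomeomorph.continuousAt_symm (hmem hb)) (by fun_prop)
  filter_upwards [hcont.eventually (hk.eventually_eq _), e.open_baseSet.mem_nhds hb] with b' h1 h2
  have h3 : ∀ {b'}, b' ∈ e.baseSet → k (s b') = k (e.toOpenPartialHomeomorph.symm (b', 1)) :=
    fun h ↦ hfib ((hs _).trans (e.proj_symm_apply (hmem h)).symm)
  rw [h3 h2, h1, h3 hb]

/-- The connection form `A + i k η`, where `η = g(ξ, ·)` and `k` is a function on the base. -/
noncomputable def twist (hπ : IsPrincipalCircleBundle E F π) (g : PseudoRiemannianMetric E B)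
    (A : ConnectionForm F P) {ξ : Π b : B, TangentSpace 𝓘(ℝ, E) b} (hξ : IsSmoothField ξ)
    {k : B → ℝ} (hk : ContMDiff 𝓘(ℝ, E) 𝓘(ℝ, ℝ) ∞ k) : ConnectionForm F P where
  form p := A.form p + ((k (π p) • g.inner (π p) (ξ (π p))) ∘L
    mfderiv 𝓘(ℝ, F) 𝓘(ℝ, E) π p).smulRight Complex.I
  contMDiff := by
    refine contMDiff_form_of_fields _ fun p X hX ↦ ?_
    have h1 : ContMDiffAt 𝓘(ℝ, F) (𝓘(ℝ, E).prod 𝓘(ℝ, ℝ)) ∞ (fun q ↦ TotalSpace.mk' ℝ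
        (E := Bundle.Trivial B ℝ) (π q) (g.inner (π q) (ξ (π q))
          (mfderiv 𝓘(ℝ, F) 𝓘(ℝ, E) π q (X q)))) p := by
      apply ContMDiffAt.clm_bundle_apply₂ (F₁ := E) (F₂ := E)
      · exact g.contMDiff.contMDiffAt.comp p hπ.contMDiff_proj.contMDiffAt
      · exact (hξ (π p)).comp p hπ.contMDiff_proj.contMDiffAt
      · exact hπ.contMDiffAt_mfderiv_proj hX
    simp only [Bundle.contMDiffAt_totalSpace] at h1
    exact (contMDiffAt_form A hX).add
      (((hk.contMDiffAt.comp p hπ.contMDiff_proj.contMDiffAt).mul h1.2).smul contMDiffAt_const)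
  re_eq_zero p u := by simp [A.re_eq_zero]
  invariant z p u := by
    have h : ∀ {b b' : B}, b = b' → ∀ w : E,
        k b * g.inner b (ξ b) w = k b' * g.inner b' (ξ b') w := by
      rintro b _ rfl w
      rfl
    have h1 := (h (hπ.proj_smul z p) _).trans
      (congrArg (fun w : E ↦ k (π p) * g.inner (π p) (ξ (π p)) w) (hπ.mfderiv_proj_smul z p u))
    exact congrArg₂ (fun (a : ℂ) (r : ℝ) ↦ a + r • Complex.I) (A.invariant z p u) h1
  fundamental a p := by
    simp [hπ.mfderiv_proj_fundamentalField, A.fundamental]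

section
variable {ξ : Π b : B, TangentSpace 𝓘(ℝ, E) b} (hξ : IsSmoothField ξ)
  {k : B → ℝ} (hk : ContMDiff 𝓘(ℝ, E) 𝓘(ℝ, ℝ) ∞ k)

theorem twist_form (u : TangentSpace 𝓘(ℝ, F) p) :
    (hπ.twist g A hξ hk).form p u = A.form p u +
      (k (π p) * g.inner (π p) (ξ (π p)) (mfderiv 𝓘(ℝ, F) 𝓘(ℝ, E) π p u) : ℝ) * Complex.I := rfl

theorem horizontalLift_twist :
    hπ.horizontalLift (hπ.twist g A hξ hk) X = hπ.horizontalLift A X +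
      (fun q ↦ -(k (π q) * g.inner (π q) (ξ (π q)) (X (π q)))) • fundamentalField F 1 := by
  funext q
  refine (hπ.eq_horizontalLift _ ?_ ?_).symm
  · simp [twist_form, hπ.form_horizontalLift, hπ.mfderiv_horizontalLift, A.fundamental,
      hπ.mfderiv_proj_fundamentalField]
  · simp [hπ.mfderiv_horizontalLift, hπ.mfderiv_proj_fundamentalField]

/-- Adding `i k η` to the connection form adds `i d(k η)` to the curvature `-A([X̂, Ŷ])`; here for
`k` locally constant. -/
theorem twist_form_mlieBracket (hkc : IsLocallyConstant k) (hX : SmoothFieldAt X (π p))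
    (hY : SmoothFieldAt Y (π p)) :
    (hπ.twist g A hξ hk).form p (mlieBracket 𝓘(ℝ, F) (hπ.horizontalLift (hπ.twist g A hξ hk) X)
        (hπ.horizontalLift (hπ.twist g A hξ hk) Y) p) =
      A.form p (mlieBracket 𝓘(ℝ, F) (hπ.horizontalLift A X) (hπ.horizontalLift A Y) p)
        - (k (π p) * exteriorDerivative (fun b ↦ g.inner b (ξ b)) X Y (π p) : ℝ) * Complex.I := by
  have i2 : IsManifold 𝓘(ℝ, F) 2 P := .of_le (n := ∞) (by norm_cast)
  have hv := (hπ.isSmoothField_fundamentalField 1 p).mdifferentiableAt (by simp)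
  have hXl := (hπ.smoothFieldAt_horizontalLift A hX).mdifferentiableAt
  have hYl := (hπ.smoothFieldAt_horizontalLift A hY).mdifferentiableAt
  have hμ : ∀ {Z : Π b : B, TangentSpace 𝓘(ℝ, E) b}, SmoothFieldAt Z (π p) →
      MDifferentiableAt 𝓘(ℝ, E) 𝓘(ℝ, ℝ) (fun b ↦ -(k b * g.inner b (ξ b) (Z b))) (π p) := fun hZ ↦
    ((hk.contMDiffAt.mdifferentiableAt (by simp)).mul (g.mdifferentiableAt_inner
      ((hξ _).mdifferentiableAt (by simp)) hZ.mdifferentiableAt)).neg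
  have hμπ : ∀ {Z : Π b : B, TangentSpace 𝓘(ℝ, E) b}, SmoothFieldAt Z (π p) →
      MDifferentiableAt 𝓘(ℝ, F) 𝓘(ℝ, ℝ)
        (fun q ↦ -(k (π q) * g.inner (π q) (ξ (π q)) (Z (π q)))) p := fun hZ ↦
    (hμ hZ).comp p (hπ.mdifferentiableAt_proj p)
  have hvμ : ∀ {Z : Π b : B, TangentSpace 𝓘(ℝ, E) b}, SmoothFieldAt Z (π p) →
      mvfderiv 𝓘(ℝ, F) (fun q ↦ -(k (π q) * g.inner (π q) (ξ (π q)) (Z (π q)))) p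
        (fundamentalField F 1 p) = 0 := fun {Z} hZ ↦
    hπ.mvfderiv_fundamentalField_eq_zero (hμπ hZ) (fun z ↦
      congrArg (fun b ↦ -(k b * g.inner b (ξ b) (Z b))) (hπ.proj_smul z p)) 1
  have hlμ : ∀ {Z W : Π b : B, TangentSpace 𝓘(ℝ, E) b}, SmoothFieldAt Z (π p) →
      mvfderiv 𝓘(ℝ, F) (fun q ↦ -(k (π q) * g.inner (π q) (ξ (π q)) (Z (π q)))) p
        (hπ.horizontalLift A W p) =
      -(k (π p) * mvfderiv 𝓘(ℝ, E) (fun b ↦ g.inner b (ξ b) (Z b)) (π p) (W (π p))) := by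
    intro Z W hZ
    refine (mvfderiv_comp_of_related (k := fun b ↦ -(k b * g.inner b (ξ b) (Z b))) (hμ hZ)
      (hπ.mdifferentiableAt_proj p) (hπ.mfderiv_horizontalLift A W p)).trans ?_
    rw [mvfderiv_fun_neg, mvfderiv_fun_mul (hk.contMDiffAt.mdifferentiableAt (by simp))
      (g.mdifferentiableAt_inner ((hξ _).mdifferentiableAt (by simp)) hZ.mdifferentiableAt),
      hkc.mvfderiv_eq_zero]
    simp
  rw [horizontalLift_twist, horizontalLift_twist,
    mlieBracket_add_left hXl ((hμπ hX).smul_section hv),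
    mlieBracket_add_right hYl ((hμπ hY).smul_section hv),
    mlieBracket_add_right hYl ((hμπ hY).smul_section hv),
    mlieBracket_smul_right (hμπ hY) hv, mlieBracket_smul_right (hμπ hY) hv,
    mlieBracket_smul_left (hμπ hX) hv, mlieBracket_smul_left (hμπ hX) hv, hlμ hX, hlμ hY, hvμ hX,
    hπ.mlieBracket_horizontalLift_fundamentalField A hX,
    hπ.mlieBracket_fundamentalField_horizontalLift A hY, VectorField.mlieBracket_self]
  have hvY : mvfderiv 𝓘(ℝ, F) (fun q ↦ -(k (π q) * g.inner (π q) (ξ (π q)) (Y (π q)))) p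
      (((fun q ↦ -(k (π q) * g.inner (π q) (ξ (π q)) (X (π q)))) • fundamentalField F 1) p) =
        0 := by
    rw [Pi.smul_apply', map_smul, hvμ hY, smul_zero]
  rw [hvY]
  simp only [twist_form, map_add, map_smul, hπ.mfderiv_mlieBracket_horizontalLift A hX hY,
    hπ.mfderiv_proj_fundamentalField, A.fundamental, exteriorDerivative]
  apply Complex.ext <;> simp
  ring

end
end IsPrincipalCircleBundle
end Twist

/-! ### Recurrent and parallel fields -/

section Recurrent
variable {E : Type*} [NormedAddCommGroup E] [NormedSpace ℝ E] [FiniteDimensional ℝ E]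
  {B : Type*} [TopologicalSpace B] [ChartedSpace E B] [IsManifold 𝓘(ℝ, E) ∞ B]
  {F : Type*} [NormedAddCommGroup F] [NormedSpace ℝ F] [FiniteDimensional ℝ F]
  {P : Type*} [TopologicalSpace P] [ChartedSpace F P] [IsManifold 𝓘(ℝ, F) ∞ P]
  [MulAction Circle P]

/-- A recurrent field that is a nonvanishing multiple of `Z` makes `Z` recurrent. -/
theorem PseudoRiemannianMetric.IsRecurrent.exists_leviCivita_eq_smul
    {g : PseudoRiemannianMetric E B} {R Z : Π b : B, TangentSpace 𝓘(ℝ, E) b} {f : B → ℝ}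
    (hR : g.IsRecurrent R) (hf : ContMDiff 𝓘(ℝ, E) 𝓘(ℝ, ℝ) ∞ f) (hf0 : ∀ b, f b ≠ 0)
    (hZ : IsSmoothField Z) (hRZ : R = f • Z) (b : B) (u : TangentSpace 𝓘(ℝ, E) b) :
    ∃ c : ℝ, g.leviCivita Z b u = c • Z b := by
  obtain ⟨-, -, θ, -, hθ⟩ := hR
  have h1 := g.leviCivita.isCovariantDerivativeOnUniv.leibniz (x := b)
    ((hZ b).mdifferentiableAt (by simp)) (hf.contMDiffAt.mdifferentiableAt (by simp))
    (Set.mem_univ b)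
  have h2 := hθ b u
  rw [hRZ] at h2
  have h3 := congrArg (fun L : E →L[ℝ] E ↦ L u) h1
  have h4 : f b • g.leviCivita Z b u + mvfderiv 𝓘(ℝ, E) f b u • Z b = θ b u • f b • Z b :=
    h3.symm.trans h2
  refine ⟨θ b u - (f b)⁻¹ * mvfderiv 𝓘(ℝ, E) f b u, ?_⟩
  have h5 : f b • g.leviCivita Z b u =
      f b • ((θ b u - (f b)⁻¹ * mvfderiv 𝓘(ℝ, E) f b u) • Z b) := by
    rw [eq_sub_of_add_eq h4, smul_smul (f b), mul_sub, mul_inv_cancel_left₀ (hf0 b)]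
    module
  exact smul_right_injective (TangentSpace 𝓘(ℝ, E) b) (hf0 b) h5

namespace IsPrincipalCircleBundle
variable {π : P → B} (hπ : IsPrincipalCircleBundle E F π) (g : PseudoRiemannianMetric E B)
  (A : ConnectionForm F P) {σ : ℝ} (hσ : σ = 1 ∨ σ = -1)
  {X Y Z ξ : Π b : B, TangentSpace 𝓘(ℝ, E) b} {p : P} {k : P → ℝ}

theorem exists_eq_horizontalLift_add (u : TangentSpace 𝓘(ℝ, F) p) :
    ∃ (X : Π b : B, TangentSpace 𝓘(ℝ, E) b) (s : ℝ), SmoothFieldAt X (π p) ∧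
      u = hπ.horizontalLift A X p + s • fundamentalField F 1 p := by
  obtain ⟨X, hX, hXu⟩ := exists_smoothFieldAt_eq
    (mfderiv 𝓘(ℝ, F) 𝓘(ℝ, E) π p u)
  exact ⟨X, _, hX, hπ.eq_horizontalLift_add A hXu.symm⟩

theorem isSmoothField_horizontalLift_add (hξ : IsSmoothField ξ)
    (hk : ContMDiff 𝓘(ℝ, F) 𝓘(ℝ, ℝ) ∞ k) :
    IsSmoothField (fun q ↦ hπ.horizontalLift A ξ q + k q • fundamentalField F 1 q) := fun p ↦
  ContMDiffAt.add_section (hπ.smoothFieldAt_horizontalLift A (hξ _))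
    (ContMDiffAt.smul_section hk.contMDiffAt (hπ.isSmoothField_fundamentalField 1 p))

theorem kaluzaKlein_inner_add_fundamentalField :
    (hπ.kaluzaKlein g A σ hσ).inner p (hπ.horizontalLift A ξ p + k p • fundamentalField F 1 p)
      (fundamentalField F 1 p) = -σ * k p := by
  rw [kaluzaKlein_inner_fundamentalField, map_add, map_smul, hπ.form_horizontalLift, zero_add,
    Complex.smul_im, im_form_fundamentalField, smul_eq_mul, mul_one]

theorem kaluzaKlein_inner_self (a c : ℝ) :
    (hπ.kaluzaKlein g A σ hσ).inner p (a • hπ.horizontalLift A ξ p + c • fundamentalField F 1 p)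
      (a • hπ.horizontalLift A ξ p + c • fundamentalField F 1 p) =
      a ^ 2 * g.inner (π p) (ξ (π p)) (ξ (π p)) - σ * c ^ 2 := by
  rw [kaluzaKlein_inner]
  simp only [map_add, map_smul, hπ.mfderiv_horizontalLift, hπ.mfderiv_proj_fundamentalField,
    hπ.form_horizontalLift, A.fundamental, smul_apply, smul_zero, add_zero, zero_add,
    smul_eq_mul]
  simp
  ring

/-- Let `dk = 0` and `k ≠ 0`. If all covariant derivatives of `ξ̂ + k v` at `p` are multiples of
this field, they vanish: the Koszul formula gives `D_v (ξ̂ + k v) ⟂ v` and then `A([ξ̂, Ŷ]) = 0`, hence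
`D_X̂ (ξ̂ + k v) ⟂ v`, whereas `ξ̂ + k v` is not orthogonal to `v`. -/
theorem leviCivita_eq_zero_of_forall_exists_eq_smul (hξ : SmoothFieldAt ξ (π p))
    (hk : MDifferentiableAt 𝓘(ℝ, F) 𝓘(ℝ, ℝ) k p) (hdk : mvfderiv 𝓘(ℝ, F) k p = 0) (hk0 : k p ≠ 0)
    (h : ∀ u : TangentSpace 𝓘(ℝ, F) p, ∃ c : ℝ, (hπ.kaluzaKlein g A σ hσ).leviCivita
      (fun q ↦ hπ.horizontalLift A ξ q + k q • fundamentalField F 1 q) p u =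
        c • (hπ.horizontalLift A ξ p + k p • fundamentalField F 1 p))
    (u : TangentSpace 𝓘(ℝ, F) p) :
    (hπ.kaluzaKlein g A σ hσ).leviCivita
      (fun q ↦ hπ.horizontalLift A ξ q + k q • fundamentalField F 1 q) p u = 0 := by
  have hσ0 : σ ≠ 0 := by rcases hσ with rfl | rfl <;> norm_num
  have hv : SmoothFieldAt (fundamentalField F 1) p := hπ.isSmoothField_fundamentalField 1 p
  have key : ∀ w : TangentSpace 𝓘(ℝ, F) p, (hπ.kaluzaKlein g A σ hσ).inner p
      ((hπ.kaluzaKlein g A σ hσ).leviCivita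
        (fun q ↦ hπ.horizontalLift A ξ q + k q • fundamentalField F 1 q) p w)
      (fundamentalField F 1 p) = 0 → (hπ.kaluzaKlein g A σ hσ).leviCivita
        (fun q ↦ hπ.horizontalLift A ξ q + k q • fundamentalField F 1 q) p w = 0 := by
    intro w hw
    obtain ⟨c, hc⟩ := h w
    rw [hc, map_smul, smul_apply, kaluzaKlein_inner_add_fundamentalField, smul_eq_mul] at hw
    have hc0 : c = 0 := (mul_eq_zero.1 hw).resolve_right (mul_ne_zero (neg_ne_zero.2 hσ0) hk0)
    rw [hc, hc0, zero_smul]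
  have h1 : (hπ.kaluzaKlein g A σ hσ).leviCivita
      (fun q ↦ hπ.horizontalLift A ξ q + k q • fundamentalField F 1 q) p
        (fundamentalField F 1 p) = 0 := by
    refine key _ ?_
    have h2 := hπ.two_mul_inner_leviCivita_horizontalLift_add g A hσ hξ hk hdk hv hv
    rw [hπ.koszul_fundamentalField_horizontalLift_fundamentalField g A hσ hξ,
      hπ.koszul_fundamentalField_fundamentalField_fundamentalField] at h2
    linarith
  obtain ⟨X, s, hX, rfl⟩ := hπ.exists_eq_horizontalLift_add A u
  have hXl := hπ.smoothFieldAt_horizontalLift A hX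
  rw [map_add, map_smul, h1, smul_zero, add_zero]
  refine key _ ?_
  have h2 := hπ.two_mul_inner_leviCivita_horizontalLift_add g A hσ hξ hk hdk hv hXl
  rw [h1, hπ.koszul_fundamentalField_horizontalLift_horizontalLift g A hσ hξ hX,
    hπ.koszul_fundamentalField_fundamentalField_horizontalLift g A hσ hX, map_zero,
    zero_apply] at h2
  have h3 := hπ.two_mul_inner_leviCivita_horizontalLift_add g A hσ hξ hk hdk hXl hv
  rw [hπ.koszul_horizontalLift_horizontalLift_fundamentalField g A hσ hX hξ,
    hπ.koszul_horizontalLift_fundamentalField_fundamentalField g A hσ hX,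
    mlieBracket_swap_apply, map_neg, Complex.neg_im] at h3
  linarith

/-- Along horizontal fields the covariant derivative of `ξ̂ + k v` combines the covariant derivative
of `ξ` and the curvature of `A`. -/
theorem two_mul_inner_leviCivita_horizontalLift_horizontalLift (hξ : SmoothFieldAt ξ (π p))
    (hk : MDifferentiableAt 𝓘(ℝ, F) 𝓘(ℝ, ℝ) k p) (hdk : mvfderiv 𝓘(ℝ, F) k p = 0)
    (hX : SmoothFieldAt X (π p)) (hY : SmoothFieldAt Y (π p)) :
    2 * (hπ.kaluzaKlein g A σ hσ).inner p ((hπ.kaluzaKlein g A σ hσ).leviCivita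
        (fun q ↦ hπ.horizontalLift A ξ q + k q • fundamentalField F 1 q) p
          (hπ.horizontalLift A X p)) (hπ.horizontalLift A Y p) =
      2 * g.inner (π p) (g.leviCivita ξ (π p) (X (π p))) (Y (π p)) + k p * (σ *
        (A.form p (mlieBracket 𝓘(ℝ, F) (hπ.horizontalLift A X) (hπ.horizontalLift A Y) p)).im) := by
  rw [hπ.two_mul_inner_leviCivita_horizontalLift_add g A hσ hξ hk hdk
    (hπ.smoothFieldAt_horizontalLift A hX) (hπ.smoothFieldAt_horizontalLift A hY),
    hπ.koszul_horizontalLift_horizontalLift_horizontalLift g A hσ hX hξ hY,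
    hπ.koszul_horizontalLift_fundamentalField_horizontalLift g A hσ hX hY,
    g.two_mul_inner_leviCivita hX.mdifferentiableAt hξ.mdifferentiableAt hY.mdifferentiableAt]

/-- The vector field `ξ̂ + k v` is parallel if the curvature of `A` is `2 i σ k g(∇ξ, ·)` and `∇ξ` is
orthogonal to `ξ` in both arguments. -/
theorem leviCivita_eq_zero_of_form_mlieBracket (hξ : SmoothFieldAt ξ (π p))
    (hk : MDifferentiableAt 𝓘(ℝ, F) 𝓘(ℝ, ℝ) k p) (hdk : mvfderiv 𝓘(ℝ, F) k p = 0)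
    (hk1 : k p ^ 2 = 1)
    (hA : ∀ X Y : Π b : B, TangentSpace 𝓘(ℝ, E) b, SmoothFieldAt X (π p) → SmoothFieldAt Y (π p) →
      (A.form p (mlieBracket 𝓘(ℝ, F) (hπ.horizontalLift A X) (hπ.horizontalLift A Y) p)).im =
        -(2 * σ * k p * g.inner (π p) (g.leviCivita ξ (π p) (X (π p))) (Y (π p))))
    (h1 : ∀ x, g.inner (π p) (g.leviCivita ξ (π p) x) (ξ (π p)) = 0)
    (h2 : ∀ x, g.inner (π p) (g.leviCivita ξ (π p) (ξ (π p))) x = 0)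
    (u : TangentSpace 𝓘(ℝ, F) p) :
    (hπ.kaluzaKlein g A σ hσ).leviCivita
      (fun q ↦ hπ.horizontalLift A ξ q + k q • fundamentalField F 1 q) p u = 0 := by
  have hσ2 : σ ^ 2 = 1 := by rcases hσ with rfl | rfl <;> norm_num
  have hv : SmoothFieldAt (fundamentalField F 1) p := hπ.isSmoothField_fundamentalField 1 p
  refine (hπ.kaluzaKlein g A σ hσ).nondegenerate p _ fun w ↦ ?_
  obtain ⟨X, s, hX, rfl⟩ := hπ.exists_eq_horizontalLift_add A u
  obtain ⟨Y, t, hY, rfl⟩ := hπ.exists_eq_horizontalLift_add A w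
  have hXl := hπ.smoothFieldAt_horizontalLift A hX
  have hYl := hπ.smoothFieldAt_horizontalLift A hY
  have e1 := hπ.two_mul_inner_leviCivita_horizontalLift_horizontalLift g A hσ hξ hk hdk hX hY
  have e2 := hπ.two_mul_inner_leviCivita_horizontalLift_add g A hσ hξ hk hdk hXl hv
  have e3 := hπ.two_mul_inner_leviCivita_horizontalLift_add g A hσ hξ hk hdk hv hYl
  have e4 := hπ.two_mul_inner_leviCivita_horizontalLift_add g A hσ hξ hk hdk hv hv
  rw [hA X Y hX hY] at e1
  rw [hπ.koszul_horizontalLift_horizontalLift_fundamentalField g A hσ hX hξ,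
    hπ.koszul_horizontalLift_fundamentalField_fundamentalField g A hσ hX, hA X ξ hX hξ, h1] at e2
  rw [hπ.koszul_fundamentalField_horizontalLift_horizontalLift g A hσ hξ hY,
    hπ.koszul_fundamentalField_fundamentalField_horizontalLift g A hσ hY, hA ξ Y hξ hY, h2] at e3
  rw [hπ.koszul_fundamentalField_horizontalLift_fundamentalField g A hσ hξ,
    hπ.koszul_fundamentalField_fundamentalField_fundamentalField] at e4
  simp only [map_add, map_smul, add_apply, smul_apply, smul_eq_mul]
  linear_combination (1 / 2) * e1 + (t / 2) * e2 + (s / 2) * e3 + (s * t / 2) * e4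
    - g.inner (π p) (g.leviCivita ξ (π p) (X (π p))) (Y (π p)) * (σ ^ 2 * hk1 + hσ2)

end IsPrincipalCircleBundle
end Recurrent

/-! ### Curvature of a bundle with a parallel field -/

theorem isLocallyConstant_sign {M : Type*} [TopologicalSpace M] {k : M → ℝ} (hk : Continuous k)
    (h0 : ∀ x, k x ≠ 0) : IsLocallyConstant fun x ↦ Real.sign (k x) := by
  refine (IsLocallyConstant.iff_eventually_eq _).2 fun x ↦ ?_
  rcases lt_or_gt_of_ne (h0 x) with h | h
  · filter_upwards [hk.continuousAt.eventually_lt continuousAt_const h] with y hy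
    rw [Real.sign_of_neg hy, Real.sign_of_neg h]
  · filter_upwards [continuousAt_const.eventually_lt hk.continuousAt h] with y hy
    rw [Real.sign_of_pos hy, Real.sign_of_pos h]

/-- Multiplication of the values of a real bilinear form by a complex number. -/
theorem exists_bilin_eq_mul {V : Type*} [NormedAddCommGroup V] [NormedSpace ℝ V]
    (L : V →L[ℝ] V →L[ℝ] ℝ) (c : ℂ) :
    ∃ Λ : V →L[ℝ] V →L[ℝ] ℂ, ∀ x y, Λ x y = c * L x y :=
  ⟨(ContinuousLinearMap.compL ℝ V ℝ ℂ (ContinuousLinearMap.toSpanSingleton ℝ c)) ∘L L,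
    fun x y ↦ by simp [mul_comm c]⟩

section Recurrence
variable {E : Type*} [NormedAddCommGroup E] [NormedSpace ℝ E] [FiniteDimensional ℝ E]
  {B : Type*} [TopologicalSpace B] [ChartedSpace E B] [IsManifold 𝓘(ℝ, E) ∞ B]
  {F : Type*} [NormedAddCommGroup F] [NormedSpace ℝ F] [FiniteDimensional ℝ F]
  {P : Type*} [TopologicalSpace P] [ChartedSpace F P] [IsManifold 𝓘(ℝ, F) ∞ P]
  [MulAction Circle P]

namespace IsPrincipalCircleBundle
variable {π : P → B} (hπ : IsPrincipalCircleBundle E F π) (g : PseudoRiemannianMetric E B)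
  (A : ConnectionForm F P) {σ : ℝ} (hσ : σ = 1 ∨ σ = -1)
  {ξ : Π b : B, TangentSpace 𝓘(ℝ, E) b}

theorem inner_leviCivita_of_isKilling (hK : g.IsKilling ξ) {c : ℝ}
    (hc : ∀ b, g.inner b (ξ b) (ξ b) = c) (b : B) (x : TangentSpace 𝓘(ℝ, E) b) :
    g.inner b (g.leviCivita ξ b (ξ b)) x = 0 := by
  rw [(g.isKilling_iff.1 hK).2, g.inner_leviCivita_self (hK.1 b) hc, neg_zero]

theorem exteriorDerivative_inner_of_isKilling (hK : g.IsKilling ξ) {b : B}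
    {X Y : Π b : B, TangentSpace 𝓘(ℝ, E) b} (hX : SmoothFieldAt X b) (hY : SmoothFieldAt Y b) :
    exteriorDerivative (fun c ↦ g.inner c (ξ c)) X Y b =
      2 * g.inner b (g.leviCivita ξ b (X b)) (Y b) := by
  rw [g.exteriorDerivative_inner (hK.1 b) hX hY, (g.isKilling_iff.1 hK).2 b (Y b)]
  ring

/-- For a light-like field `f ξ̂ + h v` one has `f ^ 2 = h ^ 2`, without zeros. -/
theorem sq_eq_sq_of_isLightLike (hξ : ∀ b, g.inner b (ξ b) (ξ b) = σ) {f h : P → ℝ}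
    (hL : (hπ.kaluzaKlein g A σ hσ).IsLightLike
      (fun p ↦ f p • hπ.horizontalLift A ξ p + h p • fundamentalField F 1 p)) (p : P) :
    f p ^ 2 = h p ^ 2 ∧ f p ≠ 0 ∧ h p ≠ 0 := by
  have hσ0 : σ ≠ 0 := by rcases hσ with rfl | rfl <;> norm_num
  obtain ⟨h0, h1⟩ := hL p
  rw [kaluzaKlein_inner_self, hξ] at h1
  have h2 : f p ^ 2 = h p ^ 2 := mul_left_cancel₀ hσ0 (by linear_combination h1)
  have h3 : f p = 0 ↔ h p = 0 := by
    rw [← sq_eq_zero_iff, h2, sq_eq_zero_iff]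
  have h4 : f p ≠ 0 := fun hf ↦ h0 (by simp [hf, h3.1 hf])
  exact ⟨h2, h4, fun hh ↦ h4 (h3.2 hh)⟩

/-- If `ξ̂ + ε v` is parallel with `ε = ±1`, the Koszul formula determines the curvature. -/
theorem im_form_mlieBracket_of_isParallel {ε : B → ℝ} (hε : IsLocallyConstant ε)
    (hε1 : ∀ b, ε b ^ 2 = 1) (hξ : IsSmoothField ξ)
    (hpar : (hπ.kaluzaKlein g A σ hσ).IsParallel
      (fun p ↦ hπ.horizontalLift A ξ p + ε (π p) • fundamentalField F 1 p))
    {X Y : Π b : B, TangentSpace 𝓘(ℝ, E) b} {p : P} (hX : SmoothFieldAt X (π p))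
    (hY : SmoothFieldAt Y (π p)) :
    (A.form p (mlieBracket 𝓘(ℝ, F) (hπ.horizontalLift A X) (hπ.horizontalLift A Y) p)).im =
      -(2 * σ * ε (π p) * g.inner (π p) (g.leviCivita ξ (π p) (X (π p))) (Y (π p))) := by
  have hσ2 : σ ^ 2 = 1 := by rcases hσ with rfl | rfl <;> norm_num
  have hk : IsLocallyConstant fun q ↦ ε (π q) := hε.comp_continuous hπ.contMDiff_proj.continuous
  have h := hπ.two_mul_inner_leviCivita_horizontalLift_horizontalLift g A hσ (hξ (π p))
    (hk.contMDiff_real.contMDiffAt.mdifferentiableAt (by simp)) (hk.mvfderiv_eq_zero p) hX hY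
  rw [hpar.2, map_zero, zero_apply] at h
  set a := (A.form p (mlieBracket 𝓘(ℝ, F) (hπ.horizontalLift A X) (hπ.horizontalLift A Y) p)).im
  linear_combination (-σ * ε (π p)) * h - a * (σ ^ 2 * hε1 (π p) + hσ2)

theorem isKilling_of_isParallel {ε : B → ℝ} (hε : IsLocallyConstant ε)
    (hε1 : ∀ b, ε b ^ 2 = 1) (hξ : IsSmoothField ξ)
    (hpar : (hπ.kaluzaKlein g A σ hσ).IsParallel
      (fun p ↦ hπ.horizontalLift A ξ p + ε (π p) • fundamentalField F 1 p)) : g.IsKilling ξ := by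
  refine g.isKilling_iff.2 ⟨hξ, fun b u w ↦ ?_⟩
  obtain ⟨p, rfl⟩ := hπ.exists_proj_eq b
  obtain ⟨X, hX, rfl⟩ := exists_smoothFieldAt_eq u
  obtain ⟨Y, hY, rfl⟩ := exists_smoothFieldAt_eq w
  have h1 := hπ.im_form_mlieBracket_of_isParallel g A hσ hε hε1 hξ hpar hX hY
  have h2 := hπ.im_form_mlieBracket_of_isParallel g A hσ hε hε1 hξ hpar hY hX
  rw [mlieBracket_swap_apply, map_neg, Complex.neg_im, h1] at h2
  have hσ0 : σ ≠ 0 := by rcases hσ with rfl | rfl <;> norm_num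
  have hε0 : ε (π p) ≠ 0 := fun h ↦ by simpa [h] using hε1 (π p)
  refine mul_left_cancel₀ (mul_ne_zero (mul_ne_zero two_ne_zero hσ0) hε0) ?_
  linear_combination h2

end IsPrincipalCircleBundle
end Recurrence

theorem mainTheorem1
    {E : Type*} [NormedAddCommGroup E] [NormedSpace ℝ E] [FiniteDimensional ℝ E]
    {B : Type*} [TopologicalSpace B] [ChartedSpace E B] [IsManifold 𝓘(ℝ, E) ∞ B]
    {F : Type*} [NormedAddCommGroup F] [NormedSpace ℝ F] [FiniteDimensional ℝ F]
    {P : Type*} [TopologicalSpace P] [ChartedSpace F P] [IsManifold 𝓘(ℝ, F) ∞ P]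
    [MulAction Circle P] {π : P → B} (hπ : IsPrincipalCircleBundle E F π)
    (g : PseudoRiemannianMetric E B) (σ : ℝ) (hσ : σ = 1 ∨ σ = -1) :
    (∀ (A : ConnectionForm F P) (ξ : Π b : B, TangentSpace 𝓘(ℝ, E) b) (f h : P → ℝ),
      IsSmoothField ξ → (∀ b, g.inner b (ξ b) (ξ b) = σ) →
      ContMDiff 𝓘(ℝ, F) 𝓘(ℝ, ℝ) ∞ f → ContMDiff 𝓘(ℝ, F) 𝓘(ℝ, ℝ) ∞ h →
      (hπ.kaluzaKlein g A σ hσ).IsLightLike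
        (fun p ↦ f p • hπ.horizontalLift A ξ p + h p • fundamentalField F 1 p) →
      (hπ.kaluzaKlein g A σ hσ).IsRecurrent
        (fun p ↦ f p • hπ.horizontalLift A ξ p + h p • fundamentalField F 1 p) →
      ∃ ε : B → ℝ, IsLocallyConstant ε ∧ (∀ b, ε b = 1 ∨ ε b = -1) ∧
        (∀ p, Real.sign (f p * h p) = ε (π p)) ∧
        g.IsKilling ξ ∧
        (hπ.kaluzaKlein g A σ hσ).IsParallel
          (fun p ↦ hπ.horizontalLift A ξ p + ε (π p) • fundamentalField F 1 p) ∧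
        (∃ (Ω : Π b : B, TangentSpace 𝓘(ℝ, E) b →L[ℝ] TangentSpace 𝓘(ℝ, E) b →L[ℝ] ℂ)
          (φ : Π b : B, TangentSpace 𝓘(ℝ, E) b →L[ℝ] TangentSpace 𝓘(ℝ, E) b),
          hπ.IsCurvatureForm A Ω ∧
          (∀ (b : B) (x y : TangentSpace 𝓘(ℝ, E) b),
            (g.inner b (φ b x) y : ℂ) = σ * (Complex.I / 2) * Ω b x y) ∧
          (∀ b, φ b (ξ b) = 0) ∧
          (∀ (b : B) (y : TangentSpace 𝓘(ℝ, E) b), Ω b (ξ b) y = 0) ∧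
          (∀ (b : B) (x : TangentSpace 𝓘(ℝ, E) b), φ b x = -(ε b) • g.leviCivita ξ b x) ∧
          (∀ (b : B) (X Y : Π b : B, TangentSpace 𝓘(ℝ, E) b),
            SmoothFieldAt X b → SmoothFieldAt Y b →
            Ω b (X b) (Y b) =
              Complex.I * σ * ε b * exteriorDerivative (fun c ↦ g.inner c (ξ c)) X Y b)) ∧
        (∃ A₀ : ConnectionForm F P,
          (∀ (p : P) (u : TangentSpace 𝓘(ℝ, F) p), A₀.form p u = A.form p u -
            Complex.I * σ * ε (π p) *
              g.inner (π p) (ξ (π p)) (mfderiv 𝓘(ℝ, F) 𝓘(ℝ, E) π p u)) ∧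
          hπ.IsFlat A₀)) ∧
    (∀ (A₀ : ConnectionForm F P) (ξ : Π b : B, TangentSpace 𝓘(ℝ, E) b) (ε : ℝ),
      g.IsKilling ξ → (∀ b, g.inner b (ξ b) (ξ b) = σ) → hπ.IsFlat A₀ → (ε = 1 ∨ ε = -1) →
      ∃ A : ConnectionForm F P,
        (∀ (p : P) (u : TangentSpace 𝓘(ℝ, F) p), A.form p u = A₀.form p u +
          Complex.I * σ * ε * g.inner (π p) (ξ (π p)) (mfderiv 𝓘(ℝ, F) 𝓘(ℝ, E) π p u)) ∧
        (hπ.kaluzaKlein g A σ hσ).IsParallel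
          (fun p ↦ hπ.horizontalLift A ξ p + ε • fundamentalField F 1 p) ∧
        (hπ.kaluzaKlein g A σ hσ).IsLightLike
          (fun p ↦ hπ.horizontalLift A ξ p + ε • fundamentalField F 1 p)) := by
  have hσ2 : σ ^ 2 = 1 := by rcases hσ with rfl | rfl <;> norm_num
  have hσ2c : (σ : ℂ) ^ 2 = 1 := by exact_mod_cast hσ2
  refine ⟨fun A ξ f h hξ hξσ hf hh hL hR ↦ ?_, fun A₀ ξ ε hK hξσ hflat hε ↦ ?_⟩
  · have hfh := hπ.sq_eq_sq_of_isLightLike g A hσ hξσ hL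
    obtain ⟨ε, hεc, hε⟩ := hπ.exists_isLocallyConstant_comp_proj
      (isLocallyConstant_sign (hf.continuous.mul hh.continuous)
        fun p ↦ mul_ne_zero (hfh p).2.1 (hfh p).2.2)
    have hε1 : ∀ b, ε b = 1 ∨ ε b = -1 := fun b ↦ by
      obtain ⟨p, rfl⟩ := hπ.exists_proj_eq b
      rw [← hε]
      exact (Real.sign_apply_eq_of_ne_zero _ (mul_ne_zero (hfh p).2.1 (hfh p).2.2)).symm
    have hε2 : ∀ b, ε b ^ 2 = 1 := fun b ↦ by rcases hε1 b with h | h <;> rw [h] <;> norm_num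
    have hk : IsLocallyConstant fun q ↦ ε (π q) := hεc.comp_continuous hπ.contMDiff_proj.continuous
    have hZ := hπ.isSmoothField_horizontalLift_add A hξ (hk.contMDiff_real (E := F))
    -- as `f h = ε |f h| = ε f ^ 2`, one has `h = ε f`
    have hhf : ∀ p, h p = f p * ε (π p) := fun p ↦ by
      have h1 : f p * h p = ε (π p) * |f p * h p| := by
        rw [← hε, Pi.mul_apply]
        rcases lt_or_gt_of_ne (mul_ne_zero (hfh p).2.1 (hfh p).2.2) with h0 | h0
        · rw [Real.sign_of_neg h0, abs_of_neg h0]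
          ring
        · rw [Real.sign_of_pos h0, abs_of_pos h0, one_mul]
      have h2 : |f p * h p| = f p ^ 2 := by
        rw [abs_mul, ← (sq_eq_sq_iff_abs_eq_abs _ _).1 (hfh p).1, ← pow_two, sq_abs]
      refine mul_left_cancel₀ (hfh p).2.1 ?_
      rw [h1, h2]
      ring
    have hpar : (hπ.kaluzaKlein g A σ hσ).IsParallel
        (fun p ↦ hπ.horizontalLift A ξ p + ε (π p) • fundamentalField F 1 p) := by
      refine ⟨hZ, fun p ↦ hπ.leviCivita_eq_zero_of_forall_exists_eq_smul g A hσ (hξ _)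
        (hk.contMDiff_real.contMDiffAt.mdifferentiableAt (by simp)) (hk.mvfderiv_eq_zero p)
        (fun h0 ↦ by simpa [h0] using hε2 (π p)) fun u ↦ ?_⟩
      refine hR.exists_leviCivita_eq_smul hf (fun p ↦ (hfh p).2.1) hZ ?_ p u
      funext q
      rw [hhf, Pi.smul_apply', smul_add, smul_smul]
    have hK := hπ.isKilling_of_isParallel g A hσ hεc hε2 hξ hpar
    have hcurv : ∀ {X Y : Π b : B, TangentSpace 𝓘(ℝ, E) b} {p : P}, SmoothFieldAt X (π p) →
        SmoothFieldAt Y (π p) →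
        A.form p (mlieBracket 𝓘(ℝ, F) (hπ.horizontalLift A X) (hπ.horizontalLift A Y) p) =
          -(2 * σ * ε (π p) * g.inner (π p) (g.leviCivita ξ (π p) (X (π p))) (Y (π p)) : ℝ)
            * Complex.I := fun hX hY ↦ by
      rw [IsPrincipalCircleBundle.form_eq_im_mul_I,
        hπ.im_form_mlieBracket_of_isParallel g A hσ hεc hε2 hξ hpar hX hY, Complex.ofReal_neg]
    have hξξ := IsPrincipalCircleBundle.inner_leviCivita_of_isKilling g hK hξσ
    have hσε : IsLocallyConstant fun b ↦ -(σ * ε b) := hεc.comp fun r ↦ -(σ * r)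
    have hΩ : ∀ b : B, ∃ Λ : TangentSpace 𝓘(ℝ, E) b →L[ℝ] TangentSpace 𝓘(ℝ, E) b →L[ℝ] ℂ,
        ∀ x y, Λ x y = Complex.I * σ * ε b * 2 * g.inner b (g.leviCivita ξ b x) y := fun b ↦
      exists_bilin_eq_mul (V := E) (g.inner b ∘L g.leviCivita ξ b) _
    choose Ω hΩ using hΩ
    refine ⟨ε, hεc, hε1, hε, hK, hpar, ⟨Ω, fun b ↦ -ε b • g.leviCivita ξ b, ?_, ?_, ?_, ?_, ?_, ?_⟩,
      ⟨hπ.twist g A hξ hσε.contMDiff_real, fun p u ↦ ?_, ?_⟩⟩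
    · intro p X Y hX hY
      rw [hΩ, hcurv hX hY]
      push_cast
      ring
    · intro b x y
      rw [hΩ, smul_apply, map_smul, smul_apply, smul_eq_mul]
      push_cast
      linear_combination (-(ε b : ℂ) * g.inner b (g.leviCivita ξ b x) y) *
        (σ ^ 2 * Complex.I_sq - hσ2c)
    · intro b
      rw [smul_apply, g.nondegenerate b _ (hξξ b), smul_zero]
    · intro b y
      rw [hΩ, hξξ]
      simp
    · intro b x
      rfl
    · intro b X Y hX hY
      rw [hΩ, IsPrincipalCircleBundle.exteriorDerivative_inner_of_isKilling g hK hX hY]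
      push_cast
      ring
    · rw [hπ.twist_form]
      push_cast
      ring
    · intro p X Y hX hY
      rw [hπ.twist_form_mlieBracket g A hξ _ hσε hX hY, hcurv hX hY,
        IsPrincipalCircleBundle.exteriorDerivative_inner_of_isKilling g hK hX hY]
      simp only [zero_apply]
      push_cast
      ring
  · have hε2 : ε ^ 2 = 1 := by rcases hε with h | h <;> rw [h] <;> norm_num
    have hξ : IsSmoothField ξ := hK.1
    have hkc : IsLocallyConstant fun _ : B ↦ σ * ε := IsLocallyConstant.const _
    have hk : ContMDiff 𝓘(ℝ, E) 𝓘(ℝ, ℝ) ∞ fun _ : B ↦ σ * ε := contMDiff_const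
    have hξξ := IsPrincipalCircleBundle.inner_leviCivita_of_isKilling g hK hξσ
    refine ⟨hπ.twist g A₀ hξ hk, fun p u ↦ ?_,
      ⟨hπ.isSmoothField_horizontalLift_add _ hξ contMDiff_const, fun p ↦ ?_⟩, fun p ↦ ⟨?_, ?_⟩⟩
    · rw [hπ.twist_form]
      push_cast
      ring
    · refine hπ.leviCivita_eq_zero_of_form_mlieBracket g _ hσ (k := fun _ ↦ ε) (hξ _)
        mdifferentiableAt_const (mvfderiv_const ε) hε2 (fun X Y hX hY ↦ ?_)
        (g.inner_leviCivita_self (hξ _) hξσ) (hξξ _)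
      have h0 := hflat p X Y hX hY
      rw [zero_apply, zero_apply, zero_eq_neg] at h0
      rw [hπ.twist_form_mlieBracket g A₀ hξ hk hkc hX hY, h0,
        IsPrincipalCircleBundle.exteriorDerivative_inner_of_isKilling g hK hX hY]
      simp only [zero_sub, Complex.neg_im, Complex.mul_im, Complex.ofReal_re, Complex.ofReal_im,
        Complex.I_re, Complex.I_im]
      ring
    · intro (h0 : hπ.horizontalLift (hπ.twist g A₀ hξ hk) ξ p + ε • fundamentalField F 1 p = 0)
      have h1 := hπ.kaluzaKlein_inner_add_fundamentalField g
        (hπ.twist g A₀ hξ hk) hσ (ξ := ξ) (p := p)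
        (k := fun _ ↦ ε)
      rw [h0, map_zero, zero_apply] at h1
      rcases hσ with rfl | rfl <;> rcases hε with rfl | rfl <;> norm_num at h1
    · have h1 := hπ.kaluzaKlein_inner_self g
        (hπ.twist g A₀ hξ hk) hσ (ξ := ξ) (p := p) 1 ε
      rw [one_smul, hξσ, hε2] at h1
      rw [h1]
      ring
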